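/- **Lemma 3.1.** Write $\mathbb R^{n+1}=\mathbb R^n\times\mathbb R\ni(x,y)$, $n\ge 1$, and let $S^n\subset\mathbb R^{n+1}$, $S^{n-1}\subset\mathbb R^n$ be the unit spheres. *The cylindrical immersions.* Let $0<\alpha<\beta<1$, $\alpha<\gamma<1-\alpha$, and let $\nu,\mu\in C^\infty(\mathbb R)$ satisfy: $\nu=\gamma$ and $\mu=0$ on $[0,\alpha]$; $\nu=\mu=1$ on $[\beta,1]$; $\nu$ is strictly increasing on $[\alpha,\beta]$; $\nu(r)-r\mu(r)>0$ for $0\le r<1$; and, with $$c_1=\mu+r\mu'-\nu',\qquad c_2=\sqrt{\nu+r(c_1^2-\mu)},\qquad \rho=c_1/c_2,\qquad \psi=2r\rho'+\rho,$$ $\psi>0$ on $(\alpha,1]$. Define $\varphi:S^n\to\mathbb R^{n+1}$ by $$\varphi(x,y)=\bigl(\theta(y^2)\,x,\;y\bigr)=:(z,w),\qquad \theta(r)=\sqrt{\frac{\nu(r)-r\mu(r)}{1-r}}$$ (the poles $x=0$ being mapped to themselves), with outward unit normal $N=\frac{1}{c_2(w^2)}\bigl(z,\;c_1(w^2)\,w\bigr)$.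 For $W\subset S^{n-1}$, let $W\times D^1$ denote the set of all $(x,y)\in S^n$ with $y^2\le\alpha$ and $x/\|x\|\in W$; it is mapped by $\varphi$ into the cylinder $\{\|z\|=\sqrt\gamma,\ |w|\le\sqrt\alpha\}$. *Statement.* For every $n\ge1$ there is $\delta_0>0$, depending only on $n$, such that for every immersion $\varphi$ as above and every open geodesic ball $U\subset S^{n-1}$ of radius $\delta$, $0<\delta\le\delta_0$, there are a $C^\infty$ function $f:S^n\to\mathbb R$ and $t_0>0$ such that, for every $t\in(0,t_0)$, the normal variation $$\varphi_U:=\varphi+t\,f\,N:S^n\to\mathbb R^{n+1}$$ has the following properties: 1. $\varphi_U$ is a $C^\infty$ immersion; 2. $\varphi_U=\varphi$ on $\bigl((S^{n-1}\setminus U)\times D^1\bigr)\cup\{w^2\ge\beta\}$; 3. $\varphi_U$ has a smooth unit normal field $N_U:S^n\to S^n$ (Gauss map) with $\langle N_U,N\rangle>0$ everywhere on $S^n$, and the Gauss–Kronecker curvature $\det(dN_U)$ of $\varphi_U$ with respect to $N_U$ is positive at every point of $U\times D^1$. -/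

import Mathlib

open scoped Manifold ContDiff RealInnerProductSpace

noncomputable section

namespace FractalImmersion

/-- `ℝⁿ⁺¹ = ℝⁿ × ℝ` with its Euclidean norm; a point is written `(x, y)`. -/
abbrev Ambient (n : ℕ) : Type := WithLp 2 (EuclideanSpace ℝ (Fin n) × ℝ)

instance instFactFinrankAmbient (n : ℕ) : Fact (Module.finrank ℝ (Ambient n) = n + 1) :=
  ⟨by simp [(WithLp.linearEquiv 2 ℝ (EuclideanSpace ℝ (Fin n) × ℝ)).finrank_eq]⟩

/-- The unit sphere `Sⁿ ⊂ ℝⁿ × ℝ`, with Mathlib's manifold structure. -/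
abbrev UnitSphere (n : ℕ) : Type := Metric.sphere (0 : Ambient n) 1

/-! ### Immersions, Gauss maps and Gauss–Kronecker curvature -/

/-- The differential at `p` of a map from the sphere to the Euclidean space. -/
def differential {n : ℕ} (g : UnitSphere n → Ambient n) (p : UnitSphere n) :
    EuclideanSpace ℝ (Fin n) →ₗ[ℝ] Ambient n :=
  (mfderiv (𝓡 n) 𝓘(ℝ, Ambient n) g p : EuclideanSpace ℝ (Fin n) →L[ℝ] Ambient n).toLinearMap

/-- A smooth immersion `Sⁿ → ℝⁿ⁺¹`: a `C^∞` map whose differential is everywhere injective. -/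
structure IsSmoothImmersion {n : ℕ} (g : UnitSphere n → Ambient n) : Prop where
  smooth : ContMDiff (𝓡 n) 𝓘(ℝ, Ambient n) ∞ g
  injective : ∀ p, Function.Injective (differential g p)

/-- `N` is a Gauss map of `g`: a smooth field of unit vectors normal to `g`. -/
structure IsGaussMap {n : ℕ} (g N : UnitSphere n → Ambient n) : Prop where
  smooth : ContMDiff (𝓡 n) 𝓘(ℝ, Ambient n) ∞ N
  unit : ∀ p, ‖N p‖ = 1
  normal : ∀ p v, ⟪N p, differential g p v⟫ = 0

/-- The operator `dN` on the tangent space at `p`, i.e. the `A` with `dg ∘ A = dN`.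
For a Gauss map `N` of an immersion `g` the range of `dN` lies in the range of `dg`, so that the
choice of the left inverse of `dg` does not matter; see `shapeOperator_eq`. -/
def shapeOperator {n : ℕ} (g N : UnitSphere n → Ambient n) (p : UnitSphere n) :
    EuclideanSpace ℝ (Fin n) →ₗ[ℝ] EuclideanSpace ℝ (Fin n) :=
  (differential g p).leftInverse ∘ₗ differential N p

/-- The Gauss–Kronecker curvature `det dN` of `g` at `p`, oriented by the Gauss map `N`. -/
def gaussKronecker {n : ℕ} (g N : UnitSphere n → Ambient n) (p : UnitSphere n) : ℝ :=
  LinearMap.det (shapeOperator g N p)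

theorem shapeOperator_eq {n : ℕ} {g N : UnitSphere n → Ambient n} {p : UnitSphere n}
    (hg : Function.Injective (differential g p))
    {A : EuclideanSpace ℝ (Fin n) →ₗ[ℝ] EuclideanSpace ℝ (Fin n)}
    (hA : differential g p ∘ₗ A = differential N p) : shapeOperator g N p = A := by
  rw [shapeOperator, ← hA, ← LinearMap.comp_assoc,
    LinearMap.leftInverse_comp_of_inj (LinearMap.ker_eq_bot.2 hg), LinearMap.id_comp]

/-! ### The cylindrical immersion -/

/-- `c₁ = μ + r μ' - ν'`. -/
def c₁ (ν μ : ℝ → ℝ) (r : ℝ) : ℝ := μ r + r * deriv μ r - deriv ν r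

/-- `c₂ = √(ν + r (c₁² - μ))`. -/
def c₂ (ν μ : ℝ → ℝ) (r : ℝ) : ℝ := √(ν r + r * (c₁ ν μ r ^ 2 - μ r))

/-- `ρ = c₁ / c₂`. -/
def rho (ν μ : ℝ → ℝ) (r : ℝ) : ℝ := c₁ ν μ r / c₂ ν μ r

/-- `ψ = 2 r ρ' + ρ`, the principal curvature of the hypersurface of revolution in the direction
of its profile curve. -/
def psi (ν μ : ℝ → ℝ) (r : ℝ) : ℝ := 2 * r * deriv (rho ν μ) r + rho ν μ r

/-- The requirements on the parameters `α, β, γ` and on the functions `ν, μ` of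
`r = |y|²` from which the cylindrical immersion is made. -/
structure IsAdmissible (α β γ : ℝ) (ν μ : ℝ → ℝ) : Prop where
  alpha_pos : 0 < α
  alpha_lt_beta : α < β
  beta_lt_one : β < 1
  alpha_lt_gamma : α < γ
  gamma_lt : γ < 1 - α
  nu_smooth : ContDiff ℝ ∞ ν
  nu_left : ∀ r ∈ Set.Icc 0 α, ν r = γ
  nu_right : ∀ r ∈ Set.Icc β 1, ν r = 1
  nu_strictMono : StrictMonoOn ν (Set.Icc α β)
  mu_smooth : ContDiff ℝ ∞ μ
  mu_left : ∀ r ∈ Set.Icc 0 α, μ r = 0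
  mu_right : ∀ r ∈ Set.Icc β 1, μ r = 1
  /-- the radicand in the definition of `θ` is positive -/
  radicand_pos : ∀ r ∈ Set.Ico (0 : ℝ) 1, 0 < ν r - r * μ r
  psi_pos : ∀ r ∈ Set.Ioc α 1, 0 < psi ν μ r

/-- `θ(r) = √((ν(r) - r μ(r)) / (1 - r))`. -/
def theta (ν μ : ℝ → ℝ) (r : ℝ) : ℝ := √((ν r - r * μ r) / (1 - r))

/-- The immersion `φ(x, y) = (θ(|y|²) x, y)` of `Sⁿ`. (At the poles `x = 0`, so the value of
`θ(1)` plays no role.) -/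
def phi {n : ℕ} (ν μ : ℝ → ℝ) (p : UnitSphere n) : Ambient n :=
  WithLp.toLp 2 (theta ν μ ((p : Ambient n).snd ^ 2) • (p : Ambient n).fst, (p : Ambient n).snd)

/-- The outward normal `N(z, w) = (z, c₁(|w|²) w) / c₂(|w|²)` of `φ`, at `(z, w) = φ(p)`. -/
def phiNormal {n : ℕ} (ν μ : ℝ → ℝ) (p : UnitSphere n) : Ambient n :=
  (c₂ ν μ ((phi ν μ p).snd ^ 2))⁻¹ •
    WithLp.toLp 2 ((phi ν μ p).fst, c₁ ν μ ((phi ν μ p).snd ^ 2) * (phi ν μ p).snd)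

/-- The normal variation `q ↦ q + t f(q) N(q)` of `φ`. -/
def normalVariation {n : ℕ} (ν μ : ℝ → ℝ) (f : UnitSphere n → ℝ) (t : ℝ) (p : UnitSphere n) :
    Ambient n :=
  phi ν μ p + (t * f p) • phiNormal ν μ p

/-! ### Balls and cylindrical pieces -/

/-- The open ball of centre `c` and radius `δ` in the unit sphere `Sⁿ⁻¹ ⊂ ℝⁿ` for the geodesic
distance, which is the angle. -/
def geodesicBall {n : ℕ} (c : EuclideanSpace ℝ (Fin n)) (δ : ℝ) : Set (EuclideanSpace ℝ (Fin n)) :=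
  {u | u ∈ Metric.sphere 0 1 ∧ InnerProductGeometry.angle c u < δ}

/-- For `W ⊂ Sⁿ⁻¹`, the set `W × D¹ ⊂ Sⁿ` of the points `(x, y)` with `|y|² ≤ α` and
`x / |x| ∈ W`; here `D¹ = [-√α, √α]`. -/
def piece {n : ℕ} (α : ℝ) (W : Set (EuclideanSpace ℝ (Fin n))) : Set (UnitSphere n) :=
  {p | (p : Ambient n).snd ^ 2 ≤ α ∧ ‖(p : Ambient n).fst‖⁻¹ • (p : Ambient n).fst ∈ W}

end FractalImmersion

end

/-!
The normal variation has the factor `f = χ(⟨c, x / ‖x‖⟩ - cos δ) (1 - y²)`, cut off in `y² ≥ β`,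
where `c` is the centre of the ball `U` and `χ = expNegInvGlue` is positive exactly on the positive
reals; so `f` is positive on `U × D¹` and vanishes on the rest of the cylinder. Every radius
`δ ≤ π` is allowed, as `U` is then the set of the directions `u` with `⟨c, u⟩ > cos δ`.

*Immersion and Gauss map.* All maps extend smoothly to a neighbourhood of the sphere. For such
an extension `G`, let `frame G N p` be the endomorphism of the ambient space which is `dG` on
`pᗮ` and maps `p` to the normal `N p` of the unperturbed immersion. It is invertible for `t = 0`,
hence by compactness of the sphere for all small `t` (`exists_isUnit_frame_add`). Then `G` is an
immersion, and the inverse transpose of the frame, applied to `p`, is a smooth normal field whose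
inner product with `N` is `1` (`conormal`).

*Curvature.* On `y² ≤ α` the immersion is the radial graph `‖z‖ = R = √γ + t χ (1 - y²)` over the
cylinder, which has an explicit normal (`graphNormal`). The second fundamental form is, up to a
positive factor, `R² ‖u'‖² + 2 t R χ y'²` plus terms of order `t ‖u'‖²` and a mixed term of order
`t |χ'| ‖u'‖ |y'|`. The flat direction of the cylinder thus gets the curvature `2 t R χ`, which
is of first order in `t`, but which tends to zero at the edge of `U`. The mixed term is
nevertheless absorbed uniformly in `U`, because `χ'² ≤ C χ` (`secondForm_pos`). A positive definite
second fundamental form has positive determinant (`gaussKronecker_pos`).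

The curvature at points with `y² = α` involves derivatives of maps which are given by the explicit
formulas on one side only. Two smooth maps which agree on `y² ≤ α` have equal derivatives up to the
boundary, since the slab `y² ≤ α` has unique differentials (`fderiv_eq_of_eqOn_slab`).
-/

open scoped Manifold ContDiff RealInnerProductSpace

namespace FractalImmersion

/-- A shortcut instance, without which the search unfolds the scalar multiplications on
`Ambient n` and times out. -/
instance instContinuousSMulAmbient (n : ℕ) : ContinuousSMul ℝ (Ambient n) :=
  IsBoundedSMul.continuousSMul

/-! ### Maps of the sphere which extend to the ambient space -/

/-- The differential at `p` of the inclusion of the sphere. -/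
noncomputable def inclusionDifferential {n : ℕ} (p : UnitSphere n) :
    EuclideanSpace ℝ (Fin n) →ₗ[ℝ] Ambient n :=
  differential (fun q : UnitSphere n => (q : Ambient n)) p

theorem range_inclusionDifferential {n : ℕ} (p : UnitSphere n) :
    LinearMap.range (inclusionDifferential p) = (Submodule.span ℝ {(p : Ambient n)})ᗮ := by
  convert! range_mvfderiv_subtypeVal p

theorem inclusionDifferential_injective {n : ℕ} (p : UnitSphere n) :
    Function.Injective (inclusionDifferential p) := by
  convert! injective_mvfderiv_subtypeVal_sphere p

theorem inner_inclusionDifferential {n : ℕ} (p : UnitSphere n) (v : EuclideanSpace ℝ (Fin n)) :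
    ⟪(p : Ambient n), inclusionDifferential p v⟫ = 0 := by
  have h : inclusionDifferential p v ∈ (Submodule.span ℝ {(p : Ambient n)})ᗮ := by
    rw [← range_inclusionDifferential p]
    exact LinearMap.mem_range_self _ v
  exact Submodule.mem_orthogonal_singleton_iff_inner_right.1 h

theorem exists_inclusionDifferential_eq {n : ℕ} (p : UnitSphere n) {v : Ambient n}
    (hv : ⟪(p : Ambient n), v⟫ = 0) : ∃ w, inclusionDifferential p w = v := by
  have h : v ∈ (Submodule.span ℝ {(p : Ambient n)})ᗮ :=
    Submodule.mem_orthogonal_singleton_iff_inner_right.2 hv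
  rwa [← range_inclusionDifferential p] at h

theorem differential_comp_coe {n : ℕ} {G : Ambient n → Ambient n} {p : UnitSphere n}
    (hG : DifferentiableAt ℝ G p) (v : EuclideanSpace ℝ (Fin n)) :
    differential (fun q : UnitSphere n => G q) p v =
      fderiv ℝ G p (inclusionDifferential p v) := by
  have h1 : MDifferentiableAt (𝓡 n) 𝓘(ℝ, Ambient n)
      (fun q : UnitSphere n => (q : Ambient n)) p :=
    (contMDiff_coe_sphere (m := 1) p).mdifferentiableAt one_ne_zero
  have h2 := mfderiv_comp (I := 𝓡 n) (I' := 𝓘(ℝ, Ambient n)) (I'' := 𝓘(ℝ, Ambient n)) p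
    (g := G) hG.mdifferentiableAt h1
  have h3 : (fun q : UnitSphere n => G q) = G ∘ (fun q : UnitSphere n => (q : Ambient n)) := rfl
  unfold inclusionDifferential differential
  rw [h3, h2, mfderiv_eq_fderiv]
  rfl

theorem contMDiff_comp_coe {n : ℕ} {F : Type*} [NormedAddCommGroup F] [NormedSpace ℝ F]
    {G : Ambient n → F} (hG : ∀ p : UnitSphere n, ContDiffAt ℝ ∞ G p) :
    ContMDiff (𝓡 n) 𝓘(ℝ, F) ∞ (fun q : UnitSphere n => G q) := fun p =>
  (hG p).contMDiffAt.comp p (contMDiff_coe_sphere p)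

/-- A map with a constant value on the sphere has no derivative along the sphere. -/
theorem fderiv_eq_zero_of_const_on_sphere {n : ℕ} {F : Type*} [NormedAddCommGroup F]
    [NormedSpace ℝ F] {q : Ambient n → F} {C : F}
    (hq : ∀ p : UnitSphere n, q p = C) {p : UnitSphere n} (hd : DifferentiableAt ℝ q p)
    {v : Ambient n} (hv : ⟪(p : Ambient n), v⟫ = 0) : fderiv ℝ q p v = 0 := by
  obtain ⟨w, rfl⟩ := exists_inclusionDifferential_eq p hv
  have h1 : MDifferentiableAt (𝓡 n) 𝓘(ℝ, Ambient n)
      (fun q : UnitSphere n => (q : Ambient n)) p :=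
    (contMDiff_coe_sphere (m := 1) p).mdifferentiableAt one_ne_zero
  have h2 := mfderiv_comp (I := 𝓡 n) (I' := 𝓘(ℝ, Ambient n)) (I'' := 𝓘(ℝ, F)) p
    (g := q) hd.mdifferentiableAt h1
  have h3 : q ∘ (fun q : UnitSphere n => (q : Ambient n)) = fun _ => C := funext hq
  rw [h3, mfderiv_const, mfderiv_eq_fderiv] at h2
  exact (congrArg (fun L => L w) h2).symm

/-! ### A normal field from a transversal field -/

theorem hasDerivAt_linear_comp {E F : Type*} [NormedAddCommGroup E] [NormedSpace ℝ E]
    [NormedAddCommGroup F] [NormedSpace ℝ F] {L : E → F} (hl : IsLinearMap ℝ L)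
    (hc : Continuous L) {f : ℝ → E} {f' : E} {s : ℝ} (hf : HasDerivAt f f' s) :
    HasDerivAt (fun s => L (f s)) (L f') s :=
  (⟨hl.mk' L, hc⟩ : E →L[ℝ] F).hasFDerivAt.comp_hasDerivAt s hf

section Frame

variable {E : Type*} [NormedAddCommGroup E] [InnerProductSpace ℝ E]

theorem hasDerivAt_line (p v : E) : HasDerivAt (fun s : ℝ => p + s • v) v 0 := by
  simpa using ((hasDerivAt_id (0 : ℝ)).smul_const v).const_add p

theorem hasDerivAt_comp_line {F : Type*} [NormedAddCommGroup F] [NormedSpace ℝ F]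
    {G : E → F} {p : E} (hG : DifferentiableAt ℝ G p) (v : E) :
    HasDerivAt (fun s : ℝ => G (p + s • v)) (fderiv ℝ G p v) 0 := by
  have h : HasFDerivAt G (fderiv ℝ G p) (p + (0 : ℝ) • v) := by simpa using hG.hasFDerivAt
  exact h.comp_hasDerivAt (0 : ℝ) (hasDerivAt_line p v)

/-- The endomorphism which is `dG` on the tangent space `pᗮ` of the sphere at `p` and maps `p`
to `N p`. It is invertible exactly when `G` is immersive at `p` with `N p` transversal to it. -/
noncomputable def frame (G N : E → E) (p : E) : E →L[ℝ] E :=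
  fderiv ℝ G p ∘L (ContinuousLinearMap.id ℝ E - (innerSL ℝ p).smulRight p) +
    (innerSL ℝ p).smulRight (N p)

theorem frame_apply (G N : E → E) (p v : E) :
    frame G N p v = fderiv ℝ G p (v - ⟪p, v⟫ • p) + ⟪p, v⟫ • N p := by
  simp [frame]

theorem frame_apply_tangent (G N : E → E) {p v : E} (hv : ⟪p, v⟫ = 0) :
    frame G N p v = fderiv ℝ G p v := by
  simp [frame_apply, hv]

theorem frame_apply_self (G N : E → E) {p : E} (hp : ‖p‖ = 1) : frame G N p p = N p := by
  simp [frame_apply, hp]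

theorem contDiffAt_frame {G N : E → E} {p : E} (hG : ContDiffAt ℝ ∞ G p)
    (hN : ContDiffAt ℝ ∞ N p) : ContDiffAt ℝ ∞ (frame G N) p := by
  have h1 : ContDiffAt ℝ ∞ (fderiv ℝ G) p := hG.fderiv_right (by simp)
  have h2 : ContDiffAt ℝ ∞ (fun p : E => innerSL ℝ p) p := (innerSL ℝ).contDiff.contDiffAt
  exact (h1.clm_comp (contDiffAt_const.sub (h2.smulRight contDiffAt_id))).add (h2.smulRight hN)

theorem frame_add_smul {G K N : E → E} {p : E} (hG : DifferentiableAt ℝ G p)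
    (hK : DifferentiableAt ℝ K p) (t : ℝ) :
    frame (fun q => G q + t • K q) N p = frame G N p + t • frame K 0 p := by
  ext v
  have h : fderiv ℝ (fun q => G q + t • K q) p = fderiv ℝ G p + t • fderiv ℝ K p := by
    exact (hG.hasFDerivAt.add (hK.hasFDerivAt.const_smul t)).fderiv
  simp only [frame_apply, h, add_apply, smul_apply,
    Pi.zero_apply, smul_zero, add_zero]
  abel

/-- The vector `m` scaled to unit length. -/
noncomputable def unitVector (m : E) : E := ‖m‖⁻¹ • m

theorem norm_unitVector {m : E} (hm : m ≠ 0) : ‖unitVector m‖ = 1 := by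
  simp [unitVector, norm_smul, hm]

theorem unitVector_smul {m : E} {r : ℝ} (hr : 0 < r) : unitVector (r • m) = unitVector m := by
  rw [unitVector, unitVector, norm_smul, Real.norm_of_nonneg hr.le, smul_smul, mul_inv]
  congr 1
  field_simp

theorem contDiffAt_unitVector {F : Type*} [NormedAddCommGroup F] [NormedSpace ℝ F] {m : F → E}
    {p : F} (h : ContDiffAt ℝ ∞ m p) (h0 : m p ≠ 0) :
    ContDiffAt ℝ ∞ (fun q => unitVector (m q)) p :=
  ((h.norm ℝ h0).inv (norm_ne_zero_iff.2 h0)).smul h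

/-- The derivative of the direction of `x + s ξ`. It is orthogonal to the direction of `x`, and it
vanishes only if `ξ` is radial. -/
theorem hasDerivAt_unitVector_line {x ξ : E} (hx : x ≠ 0) :
    ∃ u', HasDerivAt (fun s : ℝ => unitVector (x + s • ξ)) u' 0 ∧ ⟪unitVector x, u'⟫ = 0 ∧
      (u' = 0 → ⟪x, ξ⟫ = 0 → ξ = 0) := by
  have hd : DifferentiableAt ℝ (unitVector : E → E) x :=
    (contDiffAt_unitVector (m := id) contDiffAt_id hx).differentiableAt (by simp)
  have hu := hasDerivAt_comp_line hd ξ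
  have hr := hasDerivAt_comp_line ((differentiableAt_id (𝕜 := ℝ) (x := x)).norm ℝ hx) ξ
  have hne : ∀ᶠ s : ℝ in nhds 0, x + s • ξ ≠ 0 := by
    have hc : ContinuousAt (fun s : ℝ => x + s • ξ) 0 := by fun_prop
    exact hc.eventually_ne (by simpa using hx)
  refine ⟨_, hu, ?_, fun h0 hxξ => ?_⟩
  · have h1 := hu.norm_sq
    have h2 : (fun s : ℝ => ‖unitVector (x + s • ξ)‖ ^ 2) =ᶠ[nhds 0] fun _ => 1 := by
      filter_upwards [hne] with s hs
      rw [norm_unitVector hs, one_pow]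
    have h3 := h1.unique ((hasDerivAt_const (0 : ℝ) (1 : ℝ)).congr_of_eventuallyEq h2)
    simpa using h3
  · have h1 := hr.smul hu
    have h2 : (fun s : ℝ => ‖id (x + s • ξ)‖ • unitVector (x + s • ξ)) =ᶠ[nhds 0]
        fun s => x + s • ξ := by
      filter_upwards [hne] with s hs
      simp [unitVector, smul_smul, hs]
    have h3 := h1.unique ((hasDerivAt_line x ξ).congr_of_eventuallyEq h2)
    rw [h0, smul_zero, zero_add, zero_smul, add_zero] at h3
    rw [← h3, inner_smul_right, unitVector, inner_smul_right, real_inner_self_eq_norm_sq] at hxξ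
    have h4 : fderiv ℝ (fun x : E => ‖id x‖) x ξ = 0 := by
      have h5 : ‖x‖ ≠ 0 := norm_ne_zero_iff.2 hx
      exact (mul_eq_zero.1 hxξ).resolve_right (by positivity)
    rw [← h3, h4, zero_smul]

/-- Scaling a normal field to unit length multiplies the second fundamental form by a positive
factor. -/
theorem inner_fderiv_unitVector {m : E → E} {p X : E} (hm : DifferentiableAt ℝ m p)
    (h0 : m p ≠ 0) (hX : ⟪X, m p⟫ = 0) (v : E) :
    ⟪X, fderiv ℝ (fun q => unitVector (m q)) p v⟫ = ‖m p‖⁻¹ * ⟪X, fderiv ℝ m p v⟫ := by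
  have hr : DifferentiableAt ℝ (fun q => ‖m q‖⁻¹) p := (hm.norm ℝ h0).inv (norm_ne_zero_iff.2 h0)
  have h : fderiv ℝ (fun q => unitVector (m q)) p = _ := (hr.hasFDerivAt.smul hm.hasFDerivAt).fderiv
  rw [h]
  simp [inner_add_right, inner_smul_right, hX]

variable [FiniteDimensional ℝ E]

/-- An immersion with a normal vector has an invertible frame. -/
theorem isUnit_frame {G N : E → E} {p : E} (hN : N p ≠ 0)
    (hG : ∀ v, ⟪p, v⟫ = 0 → fderiv ℝ G p v = 0 → v = 0)
    (hGN : ∀ v, ⟪p, v⟫ = 0 → ⟪N p, fderiv ℝ G p v⟫ = 0) (hp : ‖p‖ = 1) :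
    IsUnit (frame G N p) := by
  rw [ContinuousLinearMap.isUnit_iff_isUnit_toLinearMap, LinearMap.isUnit_iff_ker_eq_bot,
    LinearMap.ker_eq_bot']
  intro v hv
  replace hv : fderiv ℝ G p (v - ⟪p, v⟫ • p) + ⟪p, v⟫ • N p = 0 := by
    rw [← frame_apply]; exact hv
  have ht : ⟪p, v - ⟪p, v⟫ • p⟫ = 0 := by
    simp [inner_sub_right, inner_smul_right, hp]
  have h0 : ⟪p, v⟫ = 0 := by
    have := congrArg (fun z => ⟪N p, z⟫) hv
    rw [inner_add_right, hGN _ ht, inner_smul_right, inner_zero_right, zero_add] at this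
    exact (mul_eq_zero.1 this).resolve_right (inner_self_ne_zero.2 hN)
  simp only [h0, zero_smul, sub_zero, add_zero] at hv
  exact hG v h0 hv

/-- Invertibility of the frames along a compact set persists under small variations. -/
theorem exists_isUnit_frame_add {G K N : E → E} {s : Set E} (hs : IsCompact s)
    (hG : ∀ p ∈ s, ContDiffAt ℝ ∞ G p) (hK : ∀ p ∈ s, ContDiffAt ℝ ∞ K p)
    (hN : ∀ p ∈ s, ContDiffAt ℝ ∞ N p) (h : ∀ p ∈ s, IsUnit (frame G N p)) :
    ∃ t₀ : ℝ, 0 < t₀ ∧ ∀ t ∈ Set.Ioo 0 t₀, ∀ p ∈ s,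
      IsUnit (frame (fun q => G q + t • K q) N p) := by
  have hev : ∀ᶠ t in nhds (0 : ℝ), ∀ p ∈ s, IsUnit (frame G N p + t • frame K 0 p) := by
    refine hs.eventually_forall_of_forall_eventually fun p hp => ?_
    have h1 : ContinuousAt (frame G N) p := (contDiffAt_frame (hG p hp) (hN p hp)).continuousAt
    have h2 : ContinuousAt (frame K 0) p :=
      (contDiffAt_frame (hK p hp) contDiffAt_const).continuousAt
    have h3 : ContinuousAt (fun x : ℝ × E => frame G N x.2 + x.1 • frame K 0 x.2) (0, p) := by
      have h4 : ContinuousAt (fun x : ℝ × E => frame G N x.2) (0, p) :=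
        ContinuousAt.comp (f := Prod.snd) (g := frame G N) h1 continuousAt_snd
      have h5 : ContinuousAt (fun x : ℝ × E => frame K 0 x.2) (0, p) :=
        ContinuousAt.comp (f := Prod.snd) (g := frame K 0) h2 continuousAt_snd
      have h6 : ContinuousAt (fun x : ℝ × E => x.1) (0, p) := continuousAt_fst
      exact h4.add (h6.smul h5)
    refine h3.eventually (Units.isOpen.mem_nhds ?_)
    simpa using h p hp
  obtain ⟨t₀, ht₀, ht⟩ := Metric.eventually_nhds_iff.1 hev
  refine ⟨t₀, ht₀, fun t htt p hp => ?_⟩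
  rw [frame_add_smul ((hG p hp).differentiableAt (by simp))
    ((hK p hp).differentiableAt (by simp))]
  exact ht (by simpa [abs_of_pos htt.1] using htt.2) p hp

/-- The image of `p` under the inverse transpose of `frame G N p`, written in an orthonormal
basis. It is normal to `G` along the sphere and has inner product `1` with `N`. -/
noncomputable def conormal (G N : E → E) (p : E) : E :=
  ∑ i, ⟪p, Ring.inverse (frame G N p) (stdOrthonormalBasis ℝ E i)⟫ • stdOrthonormalBasis ℝ E i

theorem inner_conormal (G N : E → E) (p z : E) :
    ⟪conormal G N p, z⟫ = ⟪p, Ring.inverse (frame G N p) z⟫ := by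
  conv_rhs => rw [← (stdOrthonormalBasis ℝ E).sum_repr' z]
  simp only [conormal, sum_inner, map_sum, inner_sum, inner_smul_left, map_smul,
    inner_smul_right, RCLike.conj_to_real]
  exact Finset.sum_congr rfl fun i _ => mul_comm _ _

theorem inner_conormal_frame {G N : E → E} {p : E} (h : IsUnit (frame G N p)) (v : E) :
    ⟪conormal G N p, frame G N p v⟫ = ⟪p, v⟫ := by
  rw [inner_conormal]
  have := Ring.inverse_mul_cancel _ h
  exact congrArg (fun z => ⟪p, z⟫) (congrArg (fun L : E →L[ℝ] E => L v) this)

theorem inner_conormal_transversal {G N : E → E} {p : E} (h : IsUnit (frame G N p))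
    (hp : ‖p‖ = 1) : ⟪conormal G N p, N p⟫ = 1 := by
  rw [← frame_apply_self G N hp, inner_conormal_frame h]
  simp [hp]

theorem conormal_ne_zero {G N : E → E} {p : E} (h : IsUnit (frame G N p)) (hp : ‖p‖ = 1) :
    conormal G N p ≠ 0 := fun h0 => by
  simpa [h0] using inner_conormal_transversal h hp

/-- The normal direction is unique: every normal vector is a multiple of `conormal`. -/
theorem eq_smul_conormal {G N : E → E} {p m : E} (h : IsUnit (frame G N p))
    (hm : ∀ v, ⟪p, v⟫ = 0 → ⟪m, fderiv ℝ G p v⟫ = 0) (hp : ‖p‖ = 1) :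
    m = ⟪m, N p⟫ • conormal G N p := by
  refine ext_inner_right ℝ fun z => ?_
  have hz : frame G N p (Ring.inverse (frame G N p) z) = z :=
    congrArg (fun L : E →L[ℝ] E => L z) (Ring.mul_inverse_cancel _ h)
  rw [← hz, inner_smul_left, inner_conormal_frame h, frame_apply, inner_add_right,
    hm _ (by simp [inner_sub_right, inner_smul_right, hp]), inner_smul_right]
  simp [mul_comm]

theorem contDiffAt_conormal {G N : E → E} {p : E} (hG : ContDiffAt ℝ ∞ G p)
    (hN : ContDiffAt ℝ ∞ N p) (h : IsUnit (frame G N p)) :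
    ContDiffAt ℝ ∞ (conormal G N) p := by
  obtain ⟨L, hL⟩ := h
  have h1 : ContDiffAt ℝ ∞ (fun q => Ring.inverse (frame G N q)) p := by
    have h2 : ContDiffAt ℝ ∞ Ring.inverse (frame G N p) := hL ▸ contDiffAt_ringInverse ℝ L
    exact h2.comp p (contDiffAt_frame hG hN)
  refine ContDiffAt.sum fun i _ => ContDiffAt.smul ?_ contDiffAt_const
  exact contDiffAt_id.inner ℝ (h1.clm_apply contDiffAt_const)

end Frame

/-! ### The sign of the Gauss–Kronecker curvature -/

/-- The determinants of `(1 - s) • id + s • A` for `s ∈ [0, 1]` do not vanish and start at `1`; no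
symmetry of the form `⟪S v, S (A w)⟫` is needed. -/
theorem det_pos_of_path {V W : Type*} [AddCommGroup V] [Module ℝ V] [FiniteDimensional ℝ V]
    [NormedAddCommGroup W] [InnerProductSpace ℝ W] {S : V →ₗ[ℝ] W} {A : V →ₗ[ℝ] V}
    (hS : Function.Injective S) (h : ∀ v, v ≠ 0 → 0 < ⟪S v, S (A v)⟫) : 0 < LinearMap.det A := by
  let D : ℝ → ℝ := fun s => LinearMap.det ((1 - s) • LinearMap.id + s • A)
  have hc : Continuous D := by
    let b := Module.finBasis ℝ V
    have : D = fun s => ((1 - s) • LinearMap.toMatrix b b LinearMap.id +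
        s • LinearMap.toMatrix b b A).det := by
      funext s
      simp only [D]
      rw [← LinearMap.det_toMatrix b, map_add, map_smul, map_smul]
    rw [this]
    refine Continuous.matrix_det ?_
    fun_prop
  have hne : ∀ s ∈ Set.Icc (0 : ℝ) 1, D s ≠ 0 := by
    intro s hs h0
    obtain ⟨v, hv, hv0⟩ := Submodule.exists_mem_ne_zero_of_ne_bot
      (LinearMap.bot_lt_ker_of_det_eq_zero h0).ne'
    have hv1 : (1 - s) • v + s • A v = 0 := by simpa using hv
    have h2 := congrArg (fun z => ⟪S v, S z⟫) hv1
    simp only [map_add, map_smul, inner_add_right, inner_smul_right, map_zero,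
      inner_zero_right] at h2
    have h3 := h v hv0
    have h4 : 0 < ⟪S v, S v⟫ :=
      real_inner_self_pos.2 fun h5 => hv0 (hS (by rw [h5, map_zero]))
    rcases eq_or_lt_of_le hs.1 with h6 | h6
    · rw [← h6] at h2; linarith
    · nlinarith [mul_pos h6 h3, mul_nonneg (sub_nonneg.2 hs.2) h4.le]
  by_contra hneg
  have h0 : D 0 = 1 := by simp [D]
  have h1 : D 1 ≤ 0 := by simpa [D] using hneg
  obtain ⟨s, hs, hs0⟩ := intermediate_value_Icc' zero_le_one hc.continuousOn
    (show (0 : ℝ) ∈ Set.Icc (D 1) (D 0) from ⟨h1, h0 ▸ zero_le_one⟩)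
  exact hne s hs hs0

/-- The curvature is positive where the second fundamental form `⟪dg v, dN v⟫` is positive
definite. -/
theorem gaussKronecker_pos {n : ℕ} {g N : UnitSphere n → Ambient n} {p : UnitSphere n}
    (hg : Function.Injective (differential g p)) (hunit : ‖N p‖ = 1)
    (hnormal : ∀ v, ⟪N p, differential g p v⟫ = 0)
    (htangent : ∀ v, ⟪N p, differential N p v⟫ = 0)
    (h : ∀ v, v ≠ 0 → 0 < ⟪differential g p v, differential N p v⟫) :
    0 < gaussKronecker g N p := by
  have hN0 : N p ≠ 0 := fun h0 => by simp [h0] at hunit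
  have hrange : LinearMap.range (differential g p) = (Submodule.span ℝ {N p})ᗮ := by
    refine Submodule.eq_of_le_of_finrank_eq ?_ ?_
    · rintro _ ⟨v, rfl⟩
      exact Submodule.mem_orthogonal_singleton_iff_inner_right.2 (hnormal v)
    · rw [LinearMap.finrank_range_of_inj hg,
        Submodule.finrank_orthogonal_span_singleton (n := n) hN0]
      simp
  have hA : differential g p ∘ₗ shapeOperator g N p = differential N p := by
    ext1 v
    have hv : differential N p v ∈ LinearMap.range (differential g p) := by
      rw [hrange]
      exact Submodule.mem_orthogonal_singleton_iff_inner_right.2 (htangent v)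
    obtain ⟨w, hw⟩ := hv
    have hl := LinearMap.leftInverse_comp_of_inj (LinearMap.ker_eq_bot.2 hg)
    have hl' : (differential g p).leftInverse (differential g p w) = w :=
      congrArg (fun L : EuclideanSpace ℝ (Fin n) →ₗ[ℝ] EuclideanSpace ℝ (Fin n) => L w) hl
    simp only [shapeOperator, LinearMap.comp_apply, ← hw, hl']
  refine det_pos_of_path hg fun v hv => ?_
  have : differential g p (shapeOperator g N p v) = differential N p v :=
    congrArg (fun L : EuclideanSpace ℝ (Fin n) →ₗ[ℝ] Ambient n => L v) hA
  rw [this]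
  exact h v hv

/-! ### The cylindrical immersion and its normal near the sphere -/

theorem contDiff_fst (n : ℕ) : ContDiff ℝ ∞ (fun p : Ambient n => p.fst) :=
  (WithLp.fstL 2 ℝ (EuclideanSpace ℝ (Fin n)) ℝ).contDiff

theorem contDiff_snd (n : ℕ) : ContDiff ℝ ∞ (fun p : Ambient n => p.snd) :=
  (WithLp.sndL 2 ℝ (EuclideanSpace ℝ (Fin n)) ℝ).contDiff

theorem contDiff_toLp (n : ℕ) :
    ContDiff ℝ ∞ (fun z : EuclideanSpace ℝ (Fin n) × ℝ => (WithLp.toLp 2 z : Ambient n)) :=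
  (WithLp.prodContinuousLinearEquiv 2 ℝ (EuclideanSpace ℝ (Fin n)) ℝ).symm.contDiff

theorem contDiffAt_toLp {n : ℕ} {F : Type*} [NormedAddCommGroup F] [NormedSpace ℝ F]
    {f : F → EuclideanSpace ℝ (Fin n)} {g : F → ℝ} {p : F}
    (hf : ContDiffAt ℝ ∞ f p) (hg : ContDiffAt ℝ ∞ g p) :
    ContDiffAt ℝ ∞ (fun q => (WithLp.toLp 2 (f q, g q) : Ambient n)) p :=
  (contDiff_toLp n).contDiffAt.comp p (hf.prodMk hg)

theorem hasDerivAt_fst {n : ℕ} {f : ℝ → Ambient n} {f' : Ambient n} {s : ℝ}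
    (hf : HasDerivAt f f' s) : HasDerivAt (fun s => (f s).fst) f'.fst s :=
  hasDerivAt_linear_comp (L := fun p : Ambient n => p.fst) ⟨fun _ _ => rfl, fun _ _ => rfl⟩
    (contDiff_fst n).continuous hf

theorem hasDerivAt_snd {n : ℕ} {f : ℝ → Ambient n} {f' : Ambient n} {s : ℝ}
    (hf : HasDerivAt f f' s) : HasDerivAt (fun s => (f s).snd) f'.snd s :=
  hasDerivAt_linear_comp (L := fun p : Ambient n => p.snd) ⟨fun _ _ => rfl, fun _ _ => rfl⟩
    (contDiff_snd n).continuous hf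

theorem hasDerivAt_toLp {n : ℕ} {f : ℝ → EuclideanSpace ℝ (Fin n)} {g : ℝ → ℝ} {s : ℝ}
    {f' : EuclideanSpace ℝ (Fin n)} {g' : ℝ} (hf : HasDerivAt f f' s) (hg : HasDerivAt g g' s) :
    HasDerivAt (fun s => (WithLp.toLp 2 (f s, g s) : Ambient n)) (WithLp.toLp 2 (f', g')) s :=
  hasDerivAt_linear_comp
    (L := fun z : EuclideanSpace ℝ (Fin n) × ℝ => (WithLp.toLp 2 z : Ambient n))
    ⟨fun _ _ => rfl, fun _ _ => rfl⟩ (contDiff_toLp n).continuous (hf.prodMk hg)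

theorem inner_toLp {n : ℕ} (x x' : EuclideanSpace ℝ (Fin n)) (y y' : ℝ) :
    ⟪(WithLp.toLp 2 (x, y) : Ambient n), WithLp.toLp 2 (x', y')⟫ = ⟪x, x'⟫ + y * y' := by
  simp [WithLp.prod_inner_apply, mul_comm]

theorem inner_eq {n : ℕ} (p q : Ambient n) :
    ⟪p, q⟫ = ⟪p.fst, q.fst⟫ + p.snd * q.snd := by
  simp [WithLp.prod_inner_apply, mul_comm]

theorem norm_sq_fst_add {n : ℕ} (p : UnitSphere n) :
    ‖(p : Ambient n).fst‖ ^ 2 + (p : Ambient n).snd ^ 2 = 1 := by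
  have h := WithLp.prod_norm_sq_eq_of_L2 (p : Ambient n)
  rw [norm_eq_of_mem_sphere p] at h
  simpa using h.symm

theorem snd_sq_le_one {n : ℕ} (p : UnitSphere n) : (p : Ambient n).snd ^ 2 ≤ 1 := by
  nlinarith [norm_sq_fst_add p, sq_nonneg ‖(p : Ambient n).fst‖]

theorem fst_eq_zero {n : ℕ} {p : UnitSphere n} (h : 1 ≤ (p : Ambient n).snd ^ 2) :
    (p : Ambient n).fst = 0 := by
  have := norm_sq_fst_add p
  have h2 : ‖(p : Ambient n).fst‖ ^ 2 = 0 :=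
    le_antisymm (by linarith) (sq_nonneg _)
  simpa using h2

theorem deriv_eq_zero_of_const_on_Icc {f : ℝ → ℝ} {a b C x : ℝ} (hf : DifferentiableAt ℝ f x)
    (hab : a < b) (hC : ∀ r ∈ Set.Icc a b, f r = C) (hx : x ∈ Set.Icc a b) : deriv f x = 0 := by
  rw [← hf.derivWithin (uniqueDiffOn_Icc hab x hx), derivWithin_congr hC (hC x hx)]
  simp

section

variable {α β γ : ℝ} {ν μ : ℝ → ℝ}

theorem IsAdmissible.c₁_left (h : IsAdmissible α β γ ν μ) {r : ℝ} (hr : r ∈ Set.Icc 0 α) :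
    c₁ ν μ r = 0 := by
  rw [c₁, h.mu_left r hr, deriv_eq_zero_of_const_on_Icc
    (h.mu_smooth.differentiable (by simp) r) h.alpha_pos h.mu_left hr,
    deriv_eq_zero_of_const_on_Icc (h.nu_smooth.differentiable (by simp) r) h.alpha_pos
      h.nu_left hr]
  ring

theorem IsAdmissible.c₂_left (h : IsAdmissible α β γ ν μ) {r : ℝ} (hr : r ∈ Set.Icc 0 α) :
    c₂ ν μ r = √γ := by
  rw [c₂, h.c₁_left hr, h.mu_left r hr, h.nu_left r hr]
  simp

theorem IsAdmissible.gamma_pos (h : IsAdmissible α β γ ν μ) : 0 < γ :=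
  h.alpha_pos.trans h.alpha_lt_gamma

theorem IsAdmissible.alpha_lt_one (h : IsAdmissible α β γ ν μ) : α < 1 :=
  h.alpha_lt_beta.trans h.beta_lt_one

theorem IsAdmissible.c₁_one (h : IsAdmissible α β γ ν μ) : c₁ ν μ 1 = 1 := by
  have h1 : (1 : ℝ) ∈ Set.Icc β 1 := ⟨h.beta_lt_one.le, le_rfl⟩
  rw [c₁, h.mu_right 1 h1, deriv_eq_zero_of_const_on_Icc
    (h.mu_smooth.differentiable (by simp) 1) h.beta_lt_one h.mu_right h1,
    deriv_eq_zero_of_const_on_Icc (h.nu_smooth.differentiable (by simp) 1) h.beta_lt_one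
      h.nu_right h1]
  ring

theorem IsAdmissible.c₂_radicand_pos (h : IsAdmissible α β γ ν μ) {r : ℝ}
    (hr : r ∈ Set.Icc (0 : ℝ) 1) : 0 < ν r + r * (c₁ ν μ r ^ 2 - μ r) := by
  rcases eq_or_lt_of_le hr.2 with h1 | h1
  · have h2 : (1 : ℝ) ∈ Set.Icc β 1 := ⟨h.beta_lt_one.le, le_rfl⟩
    rw [h1, h.c₁_one, h.nu_right 1 h2, h.mu_right 1 h2]
    norm_num
  · have h3 := h.radicand_pos r ⟨hr.1, h1⟩
    nlinarith [mul_nonneg hr.1 (sq_nonneg (c₁ ν μ r))]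

theorem IsAdmissible.contDiff_c₁ (h : IsAdmissible α β γ ν μ) : ContDiff ℝ ∞ (c₁ ν μ) := by
  have h1 : ContDiff ℝ ∞ (deriv μ) := (contDiff_infty_iff_deriv.1 h.mu_smooth).2
  have h2 : ContDiff ℝ ∞ (deriv ν) := (contDiff_infty_iff_deriv.1 h.nu_smooth).2
  exact (h.mu_smooth.add (contDiff_id.mul h1)).sub h2

theorem IsAdmissible.c₂_pos (h : IsAdmissible α β γ ν μ) {r : ℝ} (hr : r ∈ Set.Icc (0 : ℝ) 1) :
    0 < c₂ ν μ r := Real.sqrt_pos.2 (h.c₂_radicand_pos hr)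

theorem IsAdmissible.contDiffAt_c₂ (h : IsAdmissible α β γ ν μ) {r : ℝ}
    (hr : r ∈ Set.Icc (0 : ℝ) 1) : ContDiffAt ℝ ∞ (c₂ ν μ) r := by
  have h1 : ContDiff ℝ ∞ fun r => ν r + r * (c₁ ν μ r ^ 2 - μ r) :=
    h.nu_smooth.add (contDiff_id.mul ((h.contDiff_c₁.pow 2).sub h.mu_smooth))
  exact h1.contDiffAt.sqrt (h.c₂_radicand_pos hr).ne'

/-- The function `theta`, continued by its value `1` on `[β, 1)`; this corrects the junk value
at `1`, so that `y ↦ thetaExt β ν μ (y ^ 2)` is smooth up to `y = ±1`. -/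
noncomputable def thetaExt (β : ℝ) (ν μ : ℝ → ℝ) (r : ℝ) : ℝ := if r < β then theta ν μ r else 1

theorem IsAdmissible.thetaExt_eq (h : IsAdmissible α β γ ν μ) {r : ℝ} (hr : r < 1) :
    thetaExt β ν μ r = theta ν μ r := by
  unfold thetaExt
  split_ifs with h1
  · rfl
  · rw [theta, h.nu_right r ⟨not_lt.1 h1, hr.le⟩, h.mu_right r ⟨not_lt.1 h1, hr.le⟩, mul_one,
      div_self (by linarith), Real.sqrt_one]

theorem IsAdmissible.thetaExt_pos (h : IsAdmissible α β γ ν μ) {r : ℝ} (hr : 0 ≤ r) :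
    0 < thetaExt β ν μ r := by
  unfold thetaExt
  split_ifs with h1
  · have h2 : r < 1 := h1.trans h.beta_lt_one
    exact Real.sqrt_pos.2 (div_pos (h.radicand_pos r ⟨hr, h2⟩) (by linarith))
  · exact one_pos

theorem IsAdmissible.thetaExt_sq (h : IsAdmissible α β γ ν μ) {r : ℝ} (hr : 0 ≤ r) (h1 : r < 1) :
    thetaExt β ν μ r ^ 2 * (1 - r) = ν r - r * μ r := by
  rw [h.thetaExt_eq h1, theta, Real.sq_sqrt
    (div_nonneg (h.radicand_pos r ⟨hr, h1⟩).le (by linarith)), div_mul_cancel₀]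
  linarith

theorem IsAdmissible.contDiff_thetaExt (h : IsAdmissible α β γ ν μ) :
    ContDiff ℝ ∞ (fun y : ℝ => thetaExt β ν μ (y ^ 2)) := by
  rw [contDiff_iff_contDiffAt]
  intro y
  rcases lt_or_ge (y ^ 2) 1 with h1 | h1
  · have h2 : (fun y : ℝ => thetaExt β ν μ (y ^ 2)) =ᶠ[nhds y]
        fun y => √((ν (y ^ 2) - y ^ 2 * μ (y ^ 2)) / (1 - y ^ 2)) := by
      have h3 : ContinuousAt (fun y : ℝ => y ^ 2) y := by fun_prop
      filter_upwards [h3.eventually (eventually_lt_nhds h1)] with z hz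
      exact h.thetaExt_eq hz
    refine ContDiffAt.congr_of_eventuallyEq ?_ h2
    have h4 : ContDiff ℝ ∞ (fun y : ℝ => y ^ 2) := contDiff_id.pow 2
    refine ContDiffAt.sqrt (ContDiffAt.div ?_ (contDiff_const.sub h4).contDiffAt ?_)
      (div_pos (h.radicand_pos _ ⟨sq_nonneg y, h1⟩) (by linarith)).ne'
    · exact ((h.nu_smooth.comp h4).sub (h4.mul (h.mu_smooth.comp h4))).contDiffAt
    · linarith
  · have h2 : (fun y : ℝ => thetaExt β ν μ (y ^ 2)) =ᶠ[nhds y] fun _ => 1 := by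
      have h3 : ContinuousAt (fun y : ℝ => y ^ 2) y := by fun_prop
      filter_upwards [h3.eventually (eventually_gt_nhds (h.beta_lt_one.trans_le h1))] with z hz
      exact if_neg (not_lt.2 hz.le)
    exact contDiffAt_const.congr_of_eventuallyEq h2

/-- The extension `(x, y) ↦ (θ(y²) x, y)` of the cylindrical immersion to the ambient space. -/
noncomputable def phiExt {n : ℕ} (β : ℝ) (ν μ : ℝ → ℝ) (p : Ambient n) : Ambient n :=
  WithLp.toLp 2 (thetaExt β ν μ (p.snd ^ 2) • p.fst, p.snd)

/-- The extension of `phiNormal` to a neighbourhood of the sphere. -/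
noncomputable def phiNormalExt {n : ℕ} (β : ℝ) (ν μ : ℝ → ℝ) (p : Ambient n) : Ambient n :=
  (c₂ ν μ (p.snd ^ 2))⁻¹ •
    WithLp.toLp 2 (thetaExt β ν μ (p.snd ^ 2) • p.fst, c₁ ν μ (p.snd ^ 2) * p.snd)

variable {n : ℕ}

theorem IsAdmissible.phi_eq (h : IsAdmissible α β γ ν μ) (p : UnitSphere n) :
    phi ν μ p = phiExt β ν μ (p : Ambient n) := by
  rcases lt_or_ge ((p : Ambient n).snd ^ 2) 1 with h1 | h1
  · rw [phi, phiExt, h.thetaExt_eq h1]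
  · rw [phi, phiExt, fst_eq_zero h1, smul_zero, smul_zero]

theorem IsAdmissible.phiNormal_eq (h : IsAdmissible α β γ ν μ) (p : UnitSphere n) :
    phiNormal ν μ p = phiNormalExt β ν μ (p : Ambient n) := by
  rw [phiNormal, h.phi_eq]
  rfl

theorem IsAdmissible.contDiff_phiExt (h : IsAdmissible α β γ ν μ) :
    ContDiff ℝ ∞ (phiExt β ν μ : Ambient n → Ambient n) := by
  rw [contDiff_iff_contDiffAt]
  intro p
  exact contDiffAt_toLp ((h.contDiff_thetaExt.comp (contDiff_snd n)).smul
    (contDiff_fst n)).contDiffAt (contDiff_snd n).contDiffAt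

theorem IsAdmissible.contDiffAt_phiNormalExt (h : IsAdmissible α β γ ν μ) (p : UnitSphere n) :
    ContDiffAt ℝ ∞ (phiNormalExt β ν μ : Ambient n → Ambient n) p := by
  have hr : (p : Ambient n).snd ^ 2 ∈ Set.Icc (0 : ℝ) 1 := ⟨sq_nonneg _, snd_sq_le_one p⟩
  have h1 : ContDiff ℝ ∞ (fun p : Ambient n => p.snd ^ 2) := (contDiff_snd n).pow 2
  have h2 : ContDiffAt ℝ ∞ (fun p : Ambient n => c₂ ν μ (p.snd ^ 2)) (p : Ambient n) :=
    by
    have h3 := h.contDiffAt_c₂ hr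
    generalize c₂ ν μ = g at h3 ⊢
    exact h3.comp (p : Ambient n) h1.contDiffAt
  refine (h2.inv (h.c₂_pos hr).ne').smul (contDiffAt_toLp ?_ ?_)
  · exact ((h.contDiff_thetaExt.comp (contDiff_snd n)).smul (contDiff_fst n)).contDiffAt
  · exact ((h.contDiff_c₁.comp h1).mul (contDiff_snd n)).contDiffAt

theorem IsAdmissible.phiNormalExt_ne_zero (h : IsAdmissible α β γ ν μ) (p : UnitSphere n) :
    phiNormalExt β ν μ (p : Ambient n) ≠ 0 := by
  have hr : (p : Ambient n).snd ^ 2 ∈ Set.Icc (0 : ℝ) 1 := ⟨sq_nonneg _, snd_sq_le_one p⟩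
  refine smul_ne_zero (inv_ne_zero (h.c₂_pos hr).ne') fun h0 => ?_
  have h1 : thetaExt β ν μ ((p : Ambient n).snd ^ 2) • (p : Ambient n).fst = 0 :=
    congrArg (fun q : Ambient n => q.fst) h0
  have h2 : c₁ ν μ ((p : Ambient n).snd ^ 2) * (p : Ambient n).snd = 0 :=
    congrArg (fun q : Ambient n => q.snd) h0
  have h3 : (p : Ambient n).fst = 0 :=
    (smul_eq_zero.1 h1).resolve_left (h.thetaExt_pos hr.1).ne'
  have h4 := norm_sq_fst_add p
  rw [h3, norm_zero] at h4
  have h5 : (p : Ambient n).snd ^ 2 = 1 := by linarith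
  rw [h5, h.c₁_one, one_mul] at h2
  rw [h2] at h5
  norm_num at h5

theorem hasDerivAt_fst_line (p v : Ambient n) :
    HasDerivAt (fun s : ℝ => (p + s • v).fst) v.fst 0 :=
  hasDerivAt_fst (hasDerivAt_line p v)

theorem hasDerivAt_snd_line (p v : Ambient n) :
    HasDerivAt (fun s : ℝ => (p + s • v).snd) v.snd 0 :=
  hasDerivAt_snd (hasDerivAt_line p v)

theorem IsAdmissible.fderiv_phiExt (h : IsAdmissible α β γ ν μ) (p v : Ambient n) :
    fderiv ℝ (phiExt β ν μ) p v = WithLp.toLp 2 (thetaExt β ν μ (p.snd ^ 2) • v.fst +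
      (deriv (fun y : ℝ => thetaExt β ν μ (y ^ 2)) p.snd * v.snd) • p.fst, v.snd) := by
  have h1 := hasDerivAt_comp_line (h.contDiff_phiExt.differentiable (by simp) p) v
  have hT : HasDerivAt (fun y : ℝ => thetaExt β ν μ (y ^ 2))
      (deriv (fun y : ℝ => thetaExt β ν μ (y ^ 2)) p.snd) (p + (0 : ℝ) • v).snd := by
    simpa using (h.contDiff_thetaExt.differentiable (by simp) p.snd).hasDerivAt
  have h2 := hasDerivAt_toLp ((hT.comp (0 : ℝ) (hasDerivAt_snd_line p v)).smul
    (hasDerivAt_fst_line p v)) (hasDerivAt_snd_line p v)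
  refine h1.unique (h2.congr_deriv ?_)
  simp

theorem IsAdmissible.fderiv_phiExt_injective (h : IsAdmissible α β γ ν μ) {p v : Ambient n}
    (hv : fderiv ℝ (phiExt β ν μ) p v = 0) : v = 0 := by
  rw [h.fderiv_phiExt] at hv
  have h2 : v.snd = 0 := congrArg (fun q : Ambient n => q.snd) hv
  have h1 := congrArg (fun q : Ambient n => q.fst) hv
  simp only [h2, mul_zero, zero_smul, add_zero] at h1
  have h3 : v.fst = 0 := (smul_eq_zero.1 h1).resolve_left (h.thetaExt_pos (sq_nonneg _)).ne'
  exact WithLp.ofLp_injective 2 (Prod.ext h3 h2)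

/-- The normality is the derivative of the equation `‖z‖² = ν(w²) - w² μ(w²)` which the image of
the cylindrical immersion satisfies, since `c₁ = -(ν - r μ)'`. -/
theorem IsAdmissible.inner_phiNormalExt (h : IsAdmissible α β γ ν μ) (p : UnitSphere n)
    {v : Ambient n} (hv : ⟪(p : Ambient n), v⟫ = 0) :
    ⟪phiNormalExt β ν μ (p : Ambient n), fderiv ℝ (phiExt β ν μ) (p : Ambient n) v⟫ = 0 := by
  let P : Ambient n := p
  let q : Ambient n → ℝ := fun P => ‖(phiExt β ν μ P).fst‖ ^ 2 -
    (ν (P.snd ^ 2) - P.snd ^ 2 * μ (P.snd ^ 2))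
  have hq : ∀ p : UnitSphere n, q p = 0 := by
    intro p
    have h0 := norm_sq_fst_add p
    have h1 : q p = thetaExt β ν μ ((p : Ambient n).snd ^ 2) ^ 2 * ‖(p : Ambient n).fst‖ ^ 2 -
        (ν ((p : Ambient n).snd ^ 2) - (p : Ambient n).snd ^ 2 * μ ((p : Ambient n).snd ^ 2)) := by
      simp [q, phiExt, norm_smul, mul_pow]
    rcases lt_or_ge ((p : Ambient n).snd ^ 2) 1 with h2 | h2
    · rw [h1, ← h.thetaExt_sq (sq_nonneg _) h2, eq_sub_of_add_eq h0]
      ring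
    · have h3 : (1 : ℝ) ∈ Set.Icc β 1 := ⟨h.beta_lt_one.le, le_rfl⟩
      rw [h1, le_antisymm (snd_sq_le_one p) h2, fst_eq_zero h2, h.nu_right 1 h3, h.mu_right 1 h3]
      simp
  have hsq : ContDiff ℝ ∞ (fun P : Ambient n => P.snd ^ 2) := (contDiff_snd n).pow 2
  have hqd : ContDiff ℝ ∞ q := by
    refine ContDiff.sub (ContDiff.norm_sq ℝ ((contDiff_fst n).comp h.contDiff_phiExt)) ?_
    exact (h.nu_smooth.comp hsq).sub (hsq.mul (h.mu_smooth.comp hsq))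
  have h1 := hasDerivAt_comp_line (hqd.differentiable (by simp) P) v
  rw [fderiv_eq_zero_of_const_on_sphere hq (hqd.differentiable (by simp) p) hv] at h1
  have hφ := hasDerivAt_comp_line (h.contDiff_phiExt.differentiable (by simp) P) v
  have hz : HasDerivAt (fun s : ℝ => (phiExt β ν μ (P + s • v)).fst)
      (fderiv ℝ (phiExt β ν μ) P v).fst 0 :=
    hasDerivAt_fst hφ
  have hs := (hasDerivAt_snd_line P v).pow 2
  have hν : HasDerivAt ν (deriv ν (P.snd ^ 2)) ((P + (0 : ℝ) • v).snd ^ 2) := by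
    simpa using (h.nu_smooth.differentiable (by simp) (P.snd ^ 2)).hasDerivAt
  have hμ : HasDerivAt μ (deriv μ (P.snd ^ 2)) ((P + (0 : ℝ) • v).snd ^ 2) := by
    simpa using (h.mu_smooth.differentiable (by simp) (P.snd ^ 2)).hasDerivAt
  have h2 := hz.norm_sq.sub ((hν.comp (0 : ℝ) hs).sub (hs.mul (hμ.comp (0 : ℝ) hs)))
  have h3 := h1.unique h2
  have h4 : (fderiv ℝ (phiExt β ν μ) P v).snd = v.snd := by
    rw [h.fderiv_phiExt]
    rfl
  rw [phiNormalExt, inner_smul_left, inner_eq, h4]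
  simp only [zero_smul, add_zero] at h3
  have h5 : c₁ ν μ (P.snd ^ 2) = μ (P.snd ^ 2) + P.snd ^ 2 * deriv μ (P.snd ^ 2) -
    deriv ν (P.snd ^ 2) := rfl
  have h6 : ⟪(phiExt β ν μ P).fst, (fderiv ℝ (phiExt β ν μ) P v).fst⟫ +
      c₁ ν μ (P.snd ^ 2) * P.snd * v.snd = 0 := by
    rw [h5]
    simp at h3
    linarith
  exact mul_eq_zero_of_right _ h6

theorem IsAdmissible.isUnit_frame_phi (h : IsAdmissible α β γ ν μ) (p : UnitSphere n) :
    IsUnit (frame (phiExt β ν μ) (phiNormalExt β ν μ) (p : Ambient n)) :=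
  isUnit_frame (h.phiNormalExt_ne_zero p) (fun _ _ hv => h.fderiv_phiExt_injective hv)
    (fun _ hv => h.inner_phiNormalExt p hv) (norm_eq_of_mem_sphere p)

theorem IsAdmissible.exists_isUnit_frame (h : IsAdmissible α β γ ν μ) {f : Ambient n → ℝ}
    (hf : ∀ p : UnitSphere n, ContDiffAt ℝ ∞ f p) :
    ∃ t₀ : ℝ, 0 < t₀ ∧ ∀ t ∈ Set.Ioo 0 t₀, ∀ p : UnitSphere n,
      IsUnit (frame (fun q => phiExt β ν μ q + t • (f q • phiNormalExt β ν μ q))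
        (phiNormalExt β ν μ) (p : Ambient n)) := by
  obtain ⟨t₀, ht₀, ht⟩ := exists_isUnit_frame_add (G := phiExt β ν μ)
    (K := fun q : Ambient n => f q • phiNormalExt β ν μ q) (N := phiNormalExt β ν μ)
    (isCompact_sphere (0 : Ambient n) 1) (fun p _ => h.contDiff_phiExt.contDiffAt)
    (fun p hp => (hf ⟨p, hp⟩).smul (h.contDiffAt_phiNormalExt ⟨p, hp⟩))
    (fun p hp => h.contDiffAt_phiNormalExt ⟨p, hp⟩) (fun p hp => h.isUnit_frame_phi ⟨p, hp⟩)
  exact ⟨t₀, ht₀, fun t htt p => ht t htt p p.2⟩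

end

/-! ### The cut-off function and its derivatives -/

theorem contDiff_expNegInvGlue : ContDiff ℝ ∞ expNegInvGlue :=
  contDiff_infty.2 fun m => expNegInvGlue.contDiff (n := m)

theorem hasDerivAt_expNegInvGlue (s : ℝ) :
    HasDerivAt expNegInvGlue (deriv expNegInvGlue s) s :=
  (contDiff_expNegInvGlue.differentiable (by simp) s).hasDerivAt

theorem hasDerivAt_deriv_expNegInvGlue (s : ℝ) :
    HasDerivAt (deriv expNegInvGlue) (deriv (deriv expNegInvGlue) s) s :=
  ((contDiff_infty_iff_deriv.1 contDiff_expNegInvGlue).2.differentiable (by simp) s).hasDerivAt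

/-- Besides the bounds on a compact interval there is the bound `χ'² ≤ C χ`, which controls the
mixed second derivatives of the variation at the edge of its support. -/
theorem exists_bound_expNegInvGlue : ∃ C : ℝ, 0 < C ∧ ∀ s ∈ Set.Icc (-2 : ℝ) 2,
    |deriv expNegInvGlue s| ≤ C ∧ |deriv (deriv expNegInvGlue) s| ≤ C ∧
      deriv expNegInvGlue s ^ 2 ≤ C * expNegInvGlue s := by
  have hd := contDiff_infty_iff_deriv.1 contDiff_expNegInvGlue
  have hdd := contDiff_infty_iff_deriv.1 hd.2
  obtain ⟨C₁, h₁⟩ := isCompact_Icc.exists_bound_of_continuousOn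
    (hd.2.continuous.continuousOn (s := Set.Icc (-2 : ℝ) 2))
  obtain ⟨C₂, h₂⟩ := isCompact_Icc.exists_bound_of_continuousOn
    (hdd.2.continuous.continuousOn (s := Set.Icc (-2 : ℝ) 2))
  obtain ⟨C₃, h₃⟩ := isCompact_Icc.exists_bound_of_continuousOn
    ((expNegInvGlue.continuous_polynomial_eval_inv_mul (Polynomial.X ^ 4)).continuousOn
      (s := Set.Icc (-2 : ℝ) 2))
  have hform : ∀ s, deriv expNegInvGlue s = (s⁻¹) ^ 2 * expNegInvGlue s := by
    intro s
    have h := expNegInvGlue.hasDerivAt_polynomial_eval_inv_mul 1 s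
    simpa using h.deriv
  refine ⟨|C₁| + |C₂| + |C₃| + 1, by positivity, fun s hs => ⟨?_, ?_, ?_⟩⟩
  · have := h₁ s hs
    rw [Real.norm_eq_abs] at this
    linarith [le_abs_self C₁, abs_nonneg C₂, abs_nonneg C₃]
  · have := h₂ s hs
    rw [Real.norm_eq_abs] at this
    linarith [le_abs_self C₂, abs_nonneg C₁, abs_nonneg C₃]
  · have h4 : deriv expNegInvGlue s ^ 2 = ((s⁻¹) ^ 4 * expNegInvGlue s) * expNegInvGlue s := by
      rw [hform]; ring
    rw [h4]
    refine mul_le_mul_of_nonneg_right ?_ (expNegInvGlue.nonneg s)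
    have h5 := (le_abs_self _).trans (h₃ s hs)
    simp only [Polynomial.eval_pow, Polynomial.eval_X] at h5
    linarith [le_abs_self C₃, abs_nonneg C₁, abs_nonneg C₂]

/-! ### Radial graphs over the cylinder -/

/-- The second fundamental form of the perturbed cylinder is positive definite. Here
`e = ‖u'‖²`, `T = ⟪c, u'⟫` and `y'` describe the tangent vector, `τ = ⟪c, u⟫`, and `χ, χ₁, χ₂` are the
values of the cut-off function and of its first two derivatives. -/
theorem secondForm_pos {a t C R y y' e T τ χ χ₁ χ₂ : ℝ} (ha : 0 < a) (ht : 0 < t) (hC : 0 < C)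
    (htC : 6 * t * C < a) (hR : R = a + t * ((1 - y ^ 2) * χ)) (hy : y ^ 2 ≤ 1) (hχ : 0 < χ)
    (h₁ : |χ₁| ≤ C) (h₂ : |χ₂| ≤ C) (h₁₁ : χ₁ ^ 2 ≤ C * χ) (hτ : |τ| ≤ 1) (he : T ^ 2 ≤ e)
    (hne : 0 < e ∨ y' ≠ 0) :
    0 < R ^ 2 * e + t * R * (1 - y ^ 2) * χ₁ * τ * e - t * R * (1 - y ^ 2) * χ₂ * T ^ 2 +
      4 * t * a * χ₁ * y * T * y' + 2 * t * R * χ * y' ^ 2 +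
      2 * t ^ 2 * (1 - y ^ 2) ^ 2 * χ₁ ^ 2 * T ^ 2 := by
  have hg0 : 0 ≤ 1 - y ^ 2 := by linarith
  have hg1 : 1 - y ^ 2 ≤ 1 := by nlinarith [sq_nonneg y]
  have hRa : a ≤ R := by
    rw [hR]
    have : 0 ≤ t * ((1 - y ^ 2) * χ) := by positivity
    linarith
  have hR0 : 0 < R := ha.trans_le hRa
  have he0 : 0 ≤ e := (sq_nonneg T).trans he
  have hA : -(C * e) ≤ (1 - y ^ 2) * χ₁ * τ * e := by
    have h : |(1 - y ^ 2) * χ₁ * τ| ≤ 1 * C * 1 := by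
      rw [abs_mul, abs_mul, abs_of_nonneg hg0]
      gcongr
    have := (abs_le.1 h).1
    nlinarith
  have hB : (1 - y ^ 2) * χ₂ * T ^ 2 ≤ C * e := by
    have h : (1 - y ^ 2) * χ₂ ≤ C := by
      have h3 : |(1 - y ^ 2) * χ₂| ≤ 1 * C := by
        rw [abs_mul, abs_of_nonneg hg0]
        gcongr
      linarith [le_abs_self ((1 - y ^ 2) * χ₂)]
    calc (1 - y ^ 2) * χ₂ * T ^ 2 ≤ C * T ^ 2 := mul_le_mul_of_nonneg_right h (sq_nonneg T)
      _ ≤ C * e := mul_le_mul_of_nonneg_left he hC.le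
  -- The mixed term is absorbed: `C` times the left side is
  -- `(2 C T + χ₁ y y')² + (C χ - χ₁² y²) y'²`.
  have hD : 0 ≤ 4 * C * T ^ 2 + 4 * χ₁ * y * T * y' + χ * y' ^ 2 := by
    have h1 : χ₁ ^ 2 * y ^ 2 ≤ C * χ := by nlinarith [sq_nonneg χ₁]
    have h2 : 0 ≤ C * (4 * C * T ^ 2 + 4 * χ₁ * y * T * y' + χ * y' ^ 2) := by
      nlinarith [sq_nonneg (2 * C * T + χ₁ * y * y'), mul_nonneg (sub_nonneg.2 h1) (sq_nonneg y')]
    exact nonneg_of_mul_nonneg_right h2 hC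
  have hmain : 0 < R * (R - 6 * t * C) * e + t * a * χ * y' ^ 2 := by
    have h1 : 0 < R * (R - 6 * t * C) := mul_pos hR0 (by linarith)
    have h2 : 0 < t * a * χ := by positivity
    rcases hne with h | h
    · have := mul_pos h1 h
      have := mul_nonneg h2.le (sq_nonneg y')
      linarith
    · have := mul_nonneg h1.le he0
      have := mul_pos h2 (pow_pos (abs_pos.2 h) 2)
      rw [sq_abs] at this
      linarith
  have hA' := mul_le_mul_of_nonneg_left hA (mul_pos ht hR0).le
  have hB' := mul_le_mul_of_nonneg_left hB (mul_pos ht hR0).le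
  have hD' := mul_nonneg (mul_pos ht ha).le hD
  have hE : 0 ≤ 2 * t ^ 2 * (1 - y ^ 2) ^ 2 * χ₁ ^ 2 * T ^ 2 := by positivity
  have hF : 4 * (t * a) * C * T ^ 2 ≤ 4 * t * R * C * e := by
    have h1 : t * a * C * T ^ 2 ≤ t * R * C * e := by gcongr
    linarith
  have hG : t * a * χ * y' ^ 2 ≤ t * R * χ * y' ^ 2 := by gcongr
  linarith

section Graph

variable {n : ℕ}

/-- The radius of the perturbed cylinder in the direction `u`, at height `y`. -/
noncomputable def graphRadius (a t κ : ℝ) (c u : EuclideanSpace ℝ (Fin n)) (y : ℝ) : ℝ :=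
  a + t * ((1 - y ^ 2) * expNegInvGlue (⟪c, u⟫ - κ))

/-- The point of the perturbed cylinder in the direction `u`, at height `y`. -/
noncomputable def graphPoint (a t κ : ℝ) (c u : EuclideanSpace ℝ (Fin n)) (y : ℝ) : Ambient n :=
  WithLp.toLp 2 (graphRadius a t κ c u y • u, y)

/-- A normal of the perturbed cylinder at `graphPoint a t κ c u y`: the gradient of
`‖z‖ - graphRadius a t κ c (z / ‖z‖) w`, multiplied by the radius. -/
noncomputable def graphNormal (a t κ : ℝ) (c u : EuclideanSpace ℝ (Fin n)) (y : ℝ) : Ambient n :=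
  WithLp.toLp 2 (graphRadius a t κ c u y • u -
      (t * ((1 - y ^ 2) * deriv expNegInvGlue (⟪c, u⟫ - κ))) • (c - ⟪c, u⟫ • u),
    2 * t * (y * (graphRadius a t κ c u y * expNegInvGlue (⟪c, u⟫ - κ))))

variable {a t κ : ℝ} {c : EuclideanSpace ℝ (Fin n)} {u : ℝ → EuclideanSpace ℝ (Fin n)}
  {y : ℝ → ℝ} {u' : EuclideanSpace ℝ (Fin n)} {y' : ℝ}

/-- The derivative of `graphRadius` along a curve. -/
noncomputable def graphRadiusDeriv (t κ : ℝ) (c u u' : EuclideanSpace ℝ (Fin n)) (y y' : ℝ) : ℝ :=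
  t * (-(2 * y * y') * expNegInvGlue (⟪c, u⟫ - κ) +
    (1 - y ^ 2) * (deriv expNegInvGlue (⟪c, u⟫ - κ) * ⟪c, u'⟫))

theorem hasDerivAt_inner_sub (hu : HasDerivAt u u' 0) :
    HasDerivAt (fun s => ⟪c, u s⟫ - κ) ⟪c, u'⟫ 0 := by
  have h := ((hasDerivAt_const (0 : ℝ) c).inner ℝ hu).sub_const κ
  simpa using h

theorem hasDerivAt_one_sub_sq (hy : HasDerivAt y y' 0) :
    HasDerivAt (fun s => 1 - y s ^ 2) (-(2 * y 0 * y')) 0 := by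
  have h := (hy.pow 2).const_sub 1
  simpa using h

theorem hasDerivAt_graphRadius (hu : HasDerivAt u u' 0) (hy : HasDerivAt y y' 0) :
    HasDerivAt (fun s => graphRadius a t κ c (u s) (y s))
      (graphRadiusDeriv t κ c (u 0) u' (y 0) y') 0 := by
  have h1 := (hasDerivAt_expNegInvGlue _).comp (0 : ℝ) (hasDerivAt_inner_sub (c := c) (κ := κ) hu)
  exact (((hasDerivAt_one_sub_sq hy).mul h1).const_mul t).const_add a

theorem hasDerivAt_graphPoint (hu : HasDerivAt u u' 0) (hy : HasDerivAt y y' 0) :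
    HasDerivAt (fun s => graphPoint a t κ c (u s) (y s))
      (WithLp.toLp 2 (graphRadius a t κ c (u 0) (y 0) • u' +
        graphRadiusDeriv t κ c (u 0) u' (y 0) y' • u 0, y')) 0 :=
  hasDerivAt_toLp ((hasDerivAt_graphRadius hu hy).smul hu) hy

theorem hasDerivAt_graphNormal (hu : HasDerivAt u u' 0) (hy : HasDerivAt y y' 0) :
    HasDerivAt (fun s => graphNormal a t κ c (u s) (y s))
      (WithLp.toLp 2 (graphRadius a t κ c (u 0) (y 0) • u' +
          graphRadiusDeriv t κ c (u 0) u' (y 0) y' • u 0 -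
          ((t * ((1 - y 0 ^ 2) * deriv expNegInvGlue (⟪c, u 0⟫ - κ))) •
            (-(⟪c, u 0⟫ • u' + ⟪c, u'⟫ • u 0)) +
          (t * (-(2 * y 0 * y') * deriv expNegInvGlue (⟪c, u 0⟫ - κ) +
            (1 - y 0 ^ 2) * (deriv (deriv expNegInvGlue) (⟪c, u 0⟫ - κ) * ⟪c, u'⟫))) •
            (c - ⟪c, u 0⟫ • u 0)),
        2 * t * (y' * (graphRadius a t κ c (u 0) (y 0) * expNegInvGlue (⟪c, u 0⟫ - κ)) +
          y 0 * (graphRadiusDeriv t κ c (u 0) u' (y 0) y' * expNegInvGlue (⟪c, u 0⟫ - κ) +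
            graphRadius a t κ c (u 0) (y 0) *
              (deriv expNegInvGlue (⟪c, u 0⟫ - κ) * ⟪c, u'⟫))))) 0 := by
  have hτ : HasDerivAt (fun s => ⟪c, u s⟫) ⟪c, u'⟫ 0 := by
    simpa using (hasDerivAt_const (0 : ℝ) c).inner ℝ hu
  have hR := hasDerivAt_graphRadius (a := a) (t := t) (κ := κ) (c := c) hu hy
  have h0 := (hasDerivAt_expNegInvGlue _).comp (0 : ℝ) (hasDerivAt_inner_sub (c := c) (κ := κ) hu)
  have h1 := (hasDerivAt_deriv_expNegInvGlue _).comp (0 : ℝ)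
    (hasDerivAt_inner_sub (c := c) (κ := κ) hu)
  refine hasDerivAt_toLp ?_ ?_
  · exact (hR.smul hu).sub ((((hasDerivAt_one_sub_sq hy).mul h1).const_mul t).smul
      ((hτ.smul hu).const_sub c))
  · exact (hy.mul (hR.mul h0)).const_mul (2 * t)

/-- `graphNormal` is orthogonal to the velocity of every curve in the perturbed cylinder. -/
theorem inner_graphNormal (hu1 : ‖u 0‖ = 1) (hu' : ⟪u 0, u'⟫ = 0) :
    ⟪graphNormal a t κ c (u 0) (y 0), (WithLp.toLp 2 (graphRadius a t κ c (u 0) (y 0) • u' +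
        graphRadiusDeriv t κ c (u 0) u' (y 0) y' • u 0, y') : Ambient n)⟫ = 0 := by
  rw [graphNormal, inner_toLp]
  simp only [inner_add_right, inner_sub_left, inner_smul_left, inner_smul_right, hu',
    real_inner_self_eq_norm_sq, hu1, RCLike.conj_to_real, graphRadiusDeriv]
  ring

/-- `graphPoint` and `graphNormal` have velocities `X` and `Y` with positive inner product along every
curve `(u, y)` with nonzero velocity whose direction starts in the ball. -/
theorem inner_graphPoint_graphNormal_pos {C : ℝ} (ha : 0 < a) (ht : 0 < t) (hC : 0 < C)
    (htC : 6 * t * C < a)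
    (hbound : ∀ s ∈ Set.Icc (-2 : ℝ) 2, |deriv expNegInvGlue s| ≤ C ∧
      |deriv (deriv expNegInvGlue) s| ≤ C ∧ deriv expNegInvGlue s ^ 2 ≤ C * expNegInvGlue s)
    (hu1 : ‖u 0‖ = 1) (hu' : ⟪u 0, u'⟫ = 0) (hc : ‖c‖ = 1) (hκ : |κ| ≤ 1)
    (hy1 : y 0 ^ 2 ≤ 1) (hpos : κ < ⟪c, u 0⟫) (hne : u' ≠ 0 ∨ y' ≠ 0)
    {X Y : Ambient n} (hX : HasDerivAt (fun s => graphPoint a t κ c (u s) (y s)) X 0)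
    (hY : HasDerivAt (fun s => graphNormal a t κ c (u s) (y s)) Y 0)
    (hu : HasDerivAt u u' 0) (hy : HasDerivAt y y' 0) : 0 < ⟪X, Y⟫ := by
  rw [hX.unique (hasDerivAt_graphPoint hu hy), hY.unique (hasDerivAt_graphNormal hu hy),
    inner_toLp]
  have hτ : |⟪c, u 0⟫| ≤ 1 := by
    simpa [hc, hu1] using abs_real_inner_le_norm c (u 0)
  have hs : ⟪c, u 0⟫ - κ ∈ Set.Icc (-2 : ℝ) 2 := by
    have h1 := abs_le.1 hτ
    have h2 := abs_le.1 hκ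
    constructor <;> linarith [h1.1, h1.2, h2.1, h2.2]
  obtain ⟨h₁, h₂, h₁₁⟩ := hbound _ hs
  have he : ⟪c, u'⟫ ^ 2 ≤ ‖u'‖ ^ 2 := by
    have h := abs_real_inner_le_norm c u'
    rw [hc, one_mul] at h
    exact sq_le_sq' (abs_le.1 h).1 (abs_le.1 h).2
  have hne' : 0 < ‖u'‖ ^ 2 ∨ y' ≠ 0 := hne.imp_left fun h => pow_pos (norm_pos_iff.2 h) 2
  have key := secondForm_pos (R := graphRadius a t κ c (u 0) (y 0)) ha ht hC htC rfl hy1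
    (expNegInvGlue.pos_of_pos (sub_pos.2 hpos)) h₁ h₂ h₁₁ hτ he hne'
  refine key.trans_eq ?_
  have hu'' : ⟪u', u 0⟫ = 0 := by rw [real_inner_comm, hu']
  simp only [inner_add_right, inner_sub_right, inner_add_left, inner_smul_left, inner_smul_right,
    inner_neg_right, hu', hu'', real_inner_self_eq_norm_sq, hu1, RCLike.conj_to_real,
    real_inner_comm c u', real_inner_comm c (u 0), graphRadiusDeriv]
  rw [graphRadius]
  ring

end Graph

/-! ### Derivatives on the closed cylindrical part -/

section Retraction

variable {n : ℕ}

/-- The map `(x, y) ↦ (√(1 - y²) x / ‖x‖, y)`, which retracts a neighbourhood of the sphere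
without its poles to the sphere and preserves the height. -/
noncomputable def sphereRetraction (p : Ambient n) : Ambient n :=
  WithLp.toLp 2 (√(1 - p.snd ^ 2) • unitVector p.fst, p.snd)

theorem sphereRetraction_coe (p : UnitSphere n) : sphereRetraction (p : Ambient n) = p := by
  have h := norm_sq_fst_add p
  have h1 : √(1 - (p : Ambient n).snd ^ 2) • unitVector (p : Ambient n).fst =
      (p : Ambient n).fst := by
    rw [← eq_sub_of_add_eq h, Real.sqrt_sq (norm_nonneg _), unitVector, smul_smul]
    by_cases h0 : (p : Ambient n).fst = 0
    · simp [h0]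
    · rw [mul_inv_cancel₀ (norm_ne_zero_iff.2 h0), one_smul]
  exact WithLp.ofLp_injective 2 (Prod.ext h1 rfl)

theorem sphereRetraction_mem {p : Ambient n} (h0 : p.fst ≠ 0) (h1 : p.snd ^ 2 ≤ 1) :
    sphereRetraction p ∈ Metric.sphere (0 : Ambient n) 1 := by
  rw [mem_sphere_zero_iff_norm, ← sq_eq_sq₀ (norm_nonneg _) zero_le_one,
    WithLp.prod_norm_sq_eq_of_L2]
  simp [sphereRetraction, norm_smul, norm_unitVector h0, Real.sq_sqrt (sub_nonneg.2 h1)]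

theorem contDiffAt_sphereRetraction {p : Ambient n} (h0 : p.fst ≠ 0) (h1 : p.snd ^ 2 < 1) :
    ContDiffAt ℝ ∞ (sphereRetraction : Ambient n → Ambient n) p := by
  refine contDiffAt_toLp (ContDiffAt.smul (ContDiffAt.sqrt ?_ (by linarith)) ?_)
    (contDiff_snd n).contDiffAt
  · exact (contDiff_const.sub ((contDiff_snd n).pow 2)).contDiffAt
  · exact contDiffAt_unitVector (contDiff_fst n).contDiffAt h0

theorem fderiv_sphereRetraction {p : UnitSphere n} (h0 : (p : Ambient n).fst ≠ 0)
    (h1 : (p : Ambient n).snd ^ 2 < 1) {v : Ambient n} (hv : ⟪(p : Ambient n), v⟫ = 0) :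
    fderiv ℝ sphereRetraction (p : Ambient n) v = v := by
  have hd := (contDiffAt_sphereRetraction h0 h1).differentiableAt (by simp)
  have h := fderiv_eq_zero_of_const_on_sphere (q := fun q : Ambient n => sphereRetraction q - q)
    (C := 0) (fun q => by rw [sphereRetraction_coe, sub_self]) (hd.sub differentiableAt_id) hv
  have h2 : fderiv ℝ (fun q : Ambient n => sphereRetraction q - q) (p : Ambient n) = _ :=
    (hd.hasFDerivAt.sub (hasFDerivAt_id (p : Ambient n))).fderiv
  rw [h2] at h
  exact sub_eq_zero.1 h

theorem uniqueDiffWithinAt_slab {α : ℝ} (hα : 0 < α) {p : Ambient n} (hp : p.snd ^ 2 ≤ α) :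
    UniqueDiffWithinAt ℝ {q : Ambient n | q.snd ^ 2 ≤ α} p := by
  have hconv : Convex ℝ {q : Ambient n | q.snd ^ 2 ≤ α} := by
    have h1 : ConvexOn ℝ Set.univ (fun y : ℝ => y ^ 2) := even_two.convexOn_pow
    have h2 := (h1.convex_le α).is_linear_preimage (f := fun q : Ambient n => q.snd)
      ⟨fun _ _ => rfl, fun _ _ => rfl⟩
    simpa using h2
  refine uniqueDiffOn_convex hconv ⟨0, ?_⟩ p hp
  rw [mem_interior_iff_mem_nhds]
  have hc : Continuous fun q : Ambient n => q.snd ^ 2 := ((contDiff_snd n).pow 2).continuous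
  filter_upwards [hc.continuousAt.eventually (eventually_lt_nhds
    (show ((0 : Ambient n)).snd ^ 2 < α by simpa using hα))] with q hq using hq.le

/-- Two maps which agree on the part `y² ≤ α` of the sphere have the same derivative along the
sphere there, up to the boundary `y² = α`. -/
theorem fderiv_eq_of_eqOn_slab {F : Type*} [NormedAddCommGroup F] [NormedSpace ℝ F] {α : ℝ}
    (hα : 0 < α) (hα1 : α < 1) {K₁ K₂ : Ambient n → F}
    (hK : ∀ p : UnitSphere n, (p : Ambient n).snd ^ 2 ≤ α → K₁ p = K₂ p) {p : UnitSphere n}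
    (hp : (p : Ambient n).snd ^ 2 ≤ α) (h₁ : DifferentiableAt ℝ K₁ p)
    (h₂ : DifferentiableAt ℝ K₂ p) {v : Ambient n} (hv : ⟪(p : Ambient n), v⟫ = 0) :
    fderiv ℝ K₁ (p : Ambient n) v = fderiv ℝ K₂ (p : Ambient n) v := by
  have h0 : (p : Ambient n).fst ≠ 0 := fun h0 => by
    have := norm_sq_fst_add p
    rw [h0, norm_zero] at this
    linarith
  have h1 : (p : Ambient n).snd ^ 2 < 1 := hp.trans_lt hα1
  have hd := (contDiffAt_sphereRetraction h0 h1).differentiableAt (by simp)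
  have key : ∀ K : Ambient n → F, DifferentiableAt ℝ K p →
      HasFDerivAt (fun q => K (sphereRetraction q))
        ((fderiv ℝ K (p : Ambient n)).comp (fderiv ℝ sphereRetraction (p : Ambient n)))
        (p : Ambient n) := by
    intro K h
    have h' : HasFDerivAt K (fderiv ℝ K (p : Ambient n)) (sphereRetraction (p : Ambient n)) := by
      rw [sphereRetraction_coe]
      exact h.hasFDerivAt
    exact h'.comp (p : Ambient n) hd.hasFDerivAt
  have hev : (fun q => K₁ (sphereRetraction q)) =ᶠ[nhdsWithin (p : Ambient n)
      {q : Ambient n | q.snd ^ 2 ≤ α}] fun q => K₂ (sphereRetraction q) := by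
    have hne : ∀ᶠ q : Ambient n in nhds (p : Ambient n), q.fst ≠ 0 :=
      (contDiff_fst n).continuous.continuousAt.eventually_ne h0
    filter_upwards [self_mem_nhdsWithin, mem_nhdsWithin_of_mem_nhds hne] with q hq hq0
    exact hK ⟨sphereRetraction q, sphereRetraction_mem hq0 (le_trans hq hα1.le)⟩ hq
  have h3 := (uniqueDiffWithinAt_slab hα hp).eq (key K₁ h₁).hasFDerivWithinAt
    ((key K₂ h₂).hasFDerivWithinAt.congr_of_eventuallyEq hev (hev.self_of_nhdsWithin hp))
  have h4 := congrArg (fun L : Ambient n →L[ℝ] F => L v) h3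
  simpa [fderiv_sphereRetraction h0 h1 hv] using h4

end Retraction

/-! ### The variation -/

section Variation

variable {n : ℕ} {α β γ : ℝ} {ν μ : ℝ → ℝ}

/-- The function `χ(⟨c, x / ‖x‖⟩ - κ) (1 - y²)`, cut off to vanish for `y² ≥ β`. On the sphere it
is the factor of the normal variation. -/
noncomputable def variationFactor (α β κ : ℝ) (c : EuclideanSpace ℝ (Fin n)) (p : Ambient n) : ℝ :=
  (1 - p.snd ^ 2) * expNegInvGlue (⟪c, unitVector p.fst⟫ - κ) *
    Real.smoothTransition ((β - p.snd ^ 2) / (β - α))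

theorem variationFactor_of_le (hαβ : α < β) {κ : ℝ} {c : EuclideanSpace ℝ (Fin n)} {p : Ambient n}
    (hp : p.snd ^ 2 ≤ α) : variationFactor α β κ c p =
      (1 - p.snd ^ 2) * expNegInvGlue (⟪c, unitVector p.fst⟫ - κ) := by
  rw [variationFactor, Real.smoothTransition.one_of_one_le, mul_one]
  rw [le_div_iff₀ (sub_pos.2 hαβ)]
  linarith

theorem variationFactor_of_ge (hαβ : α < β) {κ : ℝ} {c : EuclideanSpace ℝ (Fin n)} {p : Ambient n}
    (hp : β ≤ p.snd ^ 2) : variationFactor α β κ c p = 0 := by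
  rw [variationFactor, Real.smoothTransition.zero_of_nonpos, mul_zero]
  exact div_nonpos_of_nonpos_of_nonneg (by linarith) (sub_pos.2 hαβ).le

theorem contDiffAt_unitVector_fst {p : Ambient n} (h0 : p.fst ≠ 0) :
    ContDiffAt ℝ ∞ (fun q : Ambient n => unitVector q.fst) p :=
  contDiffAt_unitVector (contDiff_fst n).contDiffAt h0

theorem contDiffAt_variationFactor (hαβ : α < β) (hβ : β < 1) (κ : ℝ)
    (c : EuclideanSpace ℝ (Fin n)) (p : UnitSphere n) :
    ContDiffAt ℝ ∞ (variationFactor α β κ c) (p : Ambient n) := by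
  have hsq : ContDiff ℝ ∞ (fun q : Ambient n => q.snd ^ 2) := (contDiff_snd n).pow 2
  by_cases h0 : (p : Ambient n).fst = 0
  · have h1 : β < (p : Ambient n).snd ^ 2 := by
      have := norm_sq_fst_add p
      rw [h0, norm_zero] at this
      linarith
    refine (contDiffAt_const (c := (0 : ℝ))).congr_of_eventuallyEq ?_
    filter_upwards [hsq.continuous.continuousAt.eventually (eventually_gt_nhds h1)] with q hq
    exact variationFactor_of_ge hαβ hq.le
  · refine ContDiffAt.mul (ContDiffAt.mul ?_ ?_) ?_
    · exact (contDiff_const.sub hsq).contDiffAt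
    · exact contDiff_expNegInvGlue.contDiffAt.comp (p : Ambient n)
        ((contDiffAt_const.inner ℝ (contDiffAt_unitVector_fst h0)).sub contDiffAt_const)
    · have h2 : ContDiff ℝ ∞ Real.smoothTransition :=
        contDiff_infty.2 fun m => Real.smoothTransition.contDiff (n := m)
      exact (h2.comp ((contDiff_const.sub hsq).div_const _)).contDiffAt

/-- The varied immersion near the sphere. -/
noncomputable def variationExt (α β κ t : ℝ) (ν μ : ℝ → ℝ) (c : EuclideanSpace ℝ (Fin n))
    (p : Ambient n) : Ambient n :=
  phiExt β ν μ p + t • (variationFactor α β κ c p • phiNormalExt β ν μ p)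

theorem IsAdmissible.normalVariation_eq (h : IsAdmissible α β γ ν μ) (κ t : ℝ)
    (c : EuclideanSpace ℝ (Fin n)) :
    normalVariation ν μ (fun p : UnitSphere n => variationFactor α β κ c p) t =
      fun p : UnitSphere n => variationExt α β κ t ν μ c (p : Ambient n) := by
  funext p
  rw [normalVariation, variationExt, h.phi_eq, h.phiNormal_eq, mul_smul]

theorem IsAdmissible.contDiffAt_variationExt (h : IsAdmissible α β γ ν μ) (κ t : ℝ)
    (c : EuclideanSpace ℝ (Fin n)) (p : UnitSphere n) :
    ContDiffAt ℝ ∞ (variationExt α β κ t ν μ c) (p : Ambient n) :=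
  h.contDiff_phiExt.contDiffAt.add ((contDiffAt_const (c := t)).smul
    ((contDiffAt_variationFactor h.alpha_lt_beta h.beta_lt_one κ c p).smul
      (h.contDiffAt_phiNormalExt p)))

theorem IsAdmissible.fst_ne_zero (h : IsAdmissible α β γ ν μ) {p : UnitSphere n}
    (hp : (p : Ambient n).snd ^ 2 ≤ α) : (p : Ambient n).fst ≠ 0 := fun h0 => by
  have h1 := norm_sq_fst_add p
  rw [h0, norm_zero] at h1
  linarith [h.alpha_lt_one]

theorem IsAdmissible.thetaExt_smul_fst (h : IsAdmissible α β γ ν μ) {p : UnitSphere n}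
    (hp : (p : Ambient n).snd ^ 2 ≤ α) :
    thetaExt β ν μ ((p : Ambient n).snd ^ 2) • (p : Ambient n).fst =
      √γ • unitVector (p : Ambient n).fst := by
  have hr : (p : Ambient n).snd ^ 2 ∈ Set.Icc 0 α := ⟨sq_nonneg _, hp⟩
  rw [h.thetaExt_eq (hp.trans_lt h.alpha_lt_one), theta, h.nu_left _ hr, h.mu_left _ hr,
    ← eq_sub_of_add_eq (norm_sq_fst_add p), mul_zero, sub_zero, Real.sqrt_div h.gamma_pos.le,
    Real.sqrt_sq (norm_nonneg _), unitVector, smul_smul, div_eq_mul_inv]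

theorem IsAdmissible.phiNormalExt_cylinder (h : IsAdmissible α β γ ν μ) {p : UnitSphere n}
    (hp : (p : Ambient n).snd ^ 2 ≤ α) : phiNormalExt β ν μ (p : Ambient n) =
      WithLp.toLp 2 (unitVector (p : Ambient n).fst, 0) := by
  have hr : (p : Ambient n).snd ^ 2 ∈ Set.Icc 0 α := ⟨sq_nonneg _, hp⟩
  have hγ : √γ ≠ 0 := (Real.sqrt_pos.2 h.gamma_pos).ne'
  rw [phiNormalExt, h.thetaExt_smul_fst hp, h.c₁_left hr, h.c₂_left hr, ← WithLp.toLp_smul,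
    Prod.smul_mk, smul_smul, inv_mul_cancel₀ hγ, one_smul, zero_mul, smul_zero]

theorem IsAdmissible.variationExt_cylinder (h : IsAdmissible α β γ ν μ) {κ t : ℝ}
    {c : EuclideanSpace ℝ (Fin n)} {p : UnitSphere n} (hp : (p : Ambient n).snd ^ 2 ≤ α) :
    variationExt α β κ t ν μ c (p : Ambient n) =
      graphPoint (√γ) t κ c (unitVector (p : Ambient n).fst) (p : Ambient n).snd := by
  rw [variationExt, h.phiNormalExt_cylinder hp, phiExt, h.thetaExt_smul_fst hp,
    variationFactor_of_le h.alpha_lt_beta hp, graphPoint, graphRadius, ← WithLp.toLp_smul,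
    ← WithLp.toLp_smul, ← WithLp.toLp_add]
  simp [add_smul, mul_smul]

theorem contDiffAt_graphRadius {p : Ambient n} (h0 : p.fst ≠ 0) (a t κ : ℝ)
    (c : EuclideanSpace ℝ (Fin n)) :
    ContDiffAt ℝ ∞ (fun q : Ambient n => graphRadius a t κ c (unitVector q.fst) q.snd) p := by
  have hu := contDiffAt_unitVector_fst h0
  have hs : ContDiffAt ℝ ∞ (fun q : Ambient n => ⟪c, unitVector q.fst⟫ - κ) p :=
    (contDiffAt_const.inner ℝ hu).sub contDiffAt_const
  exact contDiffAt_const.add (contDiffAt_const.mul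
    ((contDiff_const.sub ((contDiff_snd n).pow 2)).contDiffAt.mul
      (contDiff_expNegInvGlue.contDiffAt.comp p hs)))

theorem contDiffAt_graphPoint {p : Ambient n} (h0 : p.fst ≠ 0) (a t κ : ℝ)
    (c : EuclideanSpace ℝ (Fin n)) :
    ContDiffAt ℝ ∞ (fun q : Ambient n => graphPoint a t κ c (unitVector q.fst) q.snd) p :=
  contDiffAt_toLp ((contDiffAt_graphRadius h0 a t κ c).smul (contDiffAt_unitVector_fst h0))
    (contDiff_snd n).contDiffAt

theorem contDiffAt_graphNormal {p : Ambient n} (h0 : p.fst ≠ 0) (a t κ : ℝ)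
    (c : EuclideanSpace ℝ (Fin n)) :
    ContDiffAt ℝ ∞ (fun q : Ambient n => graphNormal a t κ c (unitVector q.fst) q.snd) p := by
  have hu := contDiffAt_unitVector_fst h0
  have hR := contDiffAt_graphRadius h0 a t κ c
  have hτ : ContDiffAt ℝ ∞ (fun q : Ambient n => ⟪c, unitVector q.fst⟫) p :=
    contDiffAt_const.inner ℝ hu
  have hs : ContDiffAt ℝ ∞ (fun q : Ambient n => ⟪c, unitVector q.fst⟫ - κ) p :=
    hτ.sub contDiffAt_const
  have hy : ContDiffAt ℝ ∞ (fun q : Ambient n => q.snd) p := (contDiff_snd n).contDiffAt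
  have h1 : ContDiff ℝ ∞ (deriv expNegInvGlue) :=
    (contDiff_infty_iff_deriv.1 contDiff_expNegInvGlue).2
  refine contDiffAt_toLp ((hR.smul hu).sub (ContDiffAt.smul (contDiffAt_const.mul
    ((contDiffAt_const.sub (hy.pow 2)).mul ?_)) (contDiffAt_const.sub (hτ.smul hu))))
    (contDiffAt_const.mul (hy.mul (hR.mul ?_)))
  · exact h1.contDiffAt.comp p hs
  · exact contDiff_expNegInvGlue.contDiffAt.comp p hs

theorem graphRadius_pos {a t κ : ℝ} (ha : 0 < a) (ht : 0 < t) (c u : EuclideanSpace ℝ (Fin n))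
    {y : ℝ} (hy : y ^ 2 ≤ 1) : 0 < graphRadius a t κ c u y :=
  add_pos_of_pos_of_nonneg ha (mul_nonneg ht.le
    (mul_nonneg (sub_nonneg.2 hy) (expNegInvGlue.nonneg _)))

theorem inner_graphNormal_normal (a t κ : ℝ) (c : EuclideanSpace ℝ (Fin n))
    {u : EuclideanSpace ℝ (Fin n)} (hu : ‖u‖ = 1) (y : ℝ) :
    ⟪graphNormal a t κ c u y, (WithLp.toLp 2 (u, 0) : Ambient n)⟫ = graphRadius a t κ c u y := by
  rw [graphNormal, inner_toLp]
  simp [inner_sub_left, inner_smul_left, hu]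

/-- The unit normal field of the varied immersion. -/
noncomputable def variationNormal (α β κ t : ℝ) (ν μ : ℝ → ℝ) (c : EuclideanSpace ℝ (Fin n))
    (p : Ambient n) : Ambient n :=
  unitVector (conormal (variationExt α β κ t ν μ c) (phiNormalExt β ν μ) p)

theorem IsAdmissible.fderiv_variationExt_cylinder (h : IsAdmissible α β γ ν μ) {κ t : ℝ}
    {c : EuclideanSpace ℝ (Fin n)} {p : UnitSphere n} (hp : (p : Ambient n).snd ^ 2 ≤ α)
    {v : Ambient n} (hv : ⟪(p : Ambient n), v⟫ = 0) :
    fderiv ℝ (variationExt α β κ t ν μ c) (p : Ambient n) v =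
      fderiv ℝ (fun q : Ambient n => graphPoint (√γ) t κ c (unitVector q.fst) q.snd)
        (p : Ambient n) v :=
  fderiv_eq_of_eqOn_slab h.alpha_pos h.alpha_lt_one (fun q hq => h.variationExt_cylinder hq) hp
    ((h.contDiffAt_variationExt κ t c p).differentiableAt (by simp))
    ((contDiffAt_graphPoint (h.fst_ne_zero hp) _ t κ c).differentiableAt (by simp)) hv

theorem IsAdmissible.inner_graphNormal_fderiv (h : IsAdmissible α β γ ν μ) {κ t : ℝ}
    {c : EuclideanSpace ℝ (Fin n)} {p : UnitSphere n} (hp : (p : Ambient n).snd ^ 2 ≤ α)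
    {v : Ambient n} (hv : ⟪(p : Ambient n), v⟫ = 0) :
    ⟪graphNormal (√γ) t κ c (unitVector (p : Ambient n).fst) (p : Ambient n).snd,
      fderiv ℝ (variationExt α β κ t ν μ c) (p : Ambient n) v⟫ = 0 := by
  have h0 := h.fst_ne_zero hp
  obtain ⟨u', hu, huu', -⟩ := hasDerivAt_unitVector_line (ξ := v.fst) h0
  rw [h.fderiv_variationExt_cylinder hp hv]
  have hX := hasDerivAt_comp_line
    ((contDiffAt_graphPoint h0 (√γ) t κ c).differentiableAt (by simp)) v
  have hX' := hasDerivAt_graphPoint (a := √γ) (t := t) (κ := κ) (c := c) hu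
    (hasDerivAt_snd_line (p : Ambient n) v)
  rw [hX.unique hX']
  have h1 := inner_graphNormal (a := √γ) (t := t) (κ := κ) (c := c)
    (u := fun s : ℝ => unitVector ((p : Ambient n).fst + s • v.fst))
    (y := fun s : ℝ => ((p : Ambient n) + s • v).snd) (u' := u') (y' := v.snd)
    (by simpa using norm_unitVector h0) (by simpa using huu')
  simpa using h1

theorem IsAdmissible.variationNormal_cylinder (h : IsAdmissible α β γ ν μ) {κ t : ℝ} (ht : 0 < t)
    {c : EuclideanSpace ℝ (Fin n)} {p : UnitSphere n} (hp : (p : Ambient n).snd ^ 2 ≤ α)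
    (hunit : IsUnit (frame (variationExt α β κ t ν μ c) (phiNormalExt β ν μ) (p : Ambient n))) :
    variationNormal α β κ t ν μ c (p : Ambient n) = unitVector
      (graphNormal (√γ) t κ c (unitVector (p : Ambient n).fst) (p : Ambient n).snd) := by
  have h1 := eq_smul_conormal hunit (fun v hv => h.inner_graphNormal_fderiv hp hv)
    (norm_eq_of_mem_sphere p)
  rw [h.phiNormalExt_cylinder hp,
    inner_graphNormal_normal _ _ _ _ (norm_unitVector (h.fst_ne_zero hp))] at h1
  rw [variationNormal, h1, unitVector_smul
    (graphRadius_pos (Real.sqrt_pos.2 h.gamma_pos) ht _ _ (snd_sq_le_one p))]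

/-- The second fundamental form of the varied immersion over the ball is positive definite. -/
theorem IsAdmissible.inner_fderiv_variation_pos (h : IsAdmissible α β γ ν μ) {κ t C : ℝ}
    (ht : 0 < t) {c : EuclideanSpace ℝ (Fin n)} (hc : ‖c‖ = 1) (hκ : |κ| ≤ 1) (hC : 0 < C)
    (htC : 6 * t * C < √γ)
    (hbound : ∀ s ∈ Set.Icc (-2 : ℝ) 2, |deriv expNegInvGlue s| ≤ C ∧
      |deriv (deriv expNegInvGlue) s| ≤ C ∧ deriv expNegInvGlue s ^ 2 ≤ C * expNegInvGlue s)
    (hunit : ∀ p : UnitSphere n,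
      IsUnit (frame (variationExt α β κ t ν μ c) (phiNormalExt β ν μ) (p : Ambient n)))
    {p : UnitSphere n} (hp : (p : Ambient n).snd ^ 2 ≤ α)
    (hpos : κ < ⟪c, unitVector (p : Ambient n).fst⟫)
    {v : Ambient n} (hv : ⟪(p : Ambient n), v⟫ = 0) (hv0 : v ≠ 0) :
    0 < ⟪fderiv ℝ (variationExt α β κ t ν μ c) (p : Ambient n) v,
      fderiv ℝ (variationNormal α β κ t ν μ c) (p : Ambient n) v⟫ := by
  have h0 := h.fst_ne_zero hp
  have hγ : 0 < √γ := Real.sqrt_pos.2 h.gamma_pos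
  have hu1 := norm_unitVector h0
  have hM := (contDiffAt_graphNormal h0 (√γ) t κ c)
  have hM0 : graphNormal (√γ) t κ c (unitVector (p : Ambient n).fst) (p : Ambient n).snd ≠ 0 := by
    intro hM0
    have h1 := inner_graphNormal_normal (√γ) t κ c hu1 (p : Ambient n).snd
    rw [hM0, inner_zero_left] at h1
    exact (graphRadius_pos hγ ht c _ (snd_sq_le_one p)).ne h1
  have hN : ContDiffAt ℝ ∞ (variationNormal α β κ t ν μ c) (p : Ambient n) :=
    contDiffAt_unitVector (contDiffAt_conormal (h.contDiffAt_variationExt κ t c p)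
      (h.contDiffAt_phiNormalExt p) (hunit p))
      (conormal_ne_zero (hunit p) (norm_eq_of_mem_sphere p))
  have hNeq := fderiv_eq_of_eqOn_slab h.alpha_pos h.alpha_lt_one
    (K₂ := fun q : Ambient n =>
      unitVector (graphNormal (√γ) t κ c (unitVector q.fst) q.snd))
    (fun q hq => h.variationNormal_cylinder ht hq (hunit q)) hp (hN.differentiableAt (by simp))
    ((contDiffAt_unitVector hM hM0).differentiableAt (by simp)) hv
  rw [hNeq, inner_fderiv_unitVector (hM.differentiableAt (by simp)) hM0
    (by rw [real_inner_comm]; exact h.inner_graphNormal_fderiv hp hv),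
    h.fderiv_variationExt_cylinder hp hv]
  refine mul_pos (inv_pos.2 (norm_pos_iff.2 hM0)) ?_
  obtain ⟨u', hu, huu', hu0⟩ := hasDerivAt_unitVector_line (ξ := v.fst) h0
  have hy := hasDerivAt_snd_line (p : Ambient n) v
  have hX := hasDerivAt_comp_line
    ((contDiffAt_graphPoint h0 (√γ) t κ c).differentiableAt (by simp)) v
  have hY := hasDerivAt_comp_line (hM.differentiableAt (by simp)) v
  refine inner_graphPoint_graphNormal_pos
    (u := fun s : ℝ => unitVector ((p : Ambient n).fst + s • v.fst))
    (y := fun s : ℝ => ((p : Ambient n) + s • v).snd) hγ ht hC htC hbound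
    (by simpa using hu1) (by simpa using huu') hc hκ (by simpa using snd_sq_le_one p)
    (by simpa using hpos) ?_ hX hY hu hy
  -- If both `u'` and the vertical part vanish, then `v` is radial and tangent, hence zero.
  by_contra hcon
  rw [not_or, not_not, not_not] at hcon
  rw [inner_eq, hcon.2, mul_zero, add_zero] at hv
  exact hv0 (WithLp.ofLp_injective 2 (Prod.ext (hu0 hcon.1 hv) hcon.2))

end Variation

/-! ### The geodesic ball and the conclusion -/

theorem mem_geodesicBall_iff {n : ℕ} {c u : EuclideanSpace ℝ (Fin n)} {δ : ℝ} (hc : ‖c‖ = 1)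
    (hδ0 : 0 ≤ δ) (hδ : δ ≤ Real.pi) (hu : ‖u‖ = 1) :
    u ∈ geodesicBall c δ ↔ Real.cos δ < ⟪c, u⟫ := by
  rw [geodesicBall, Set.mem_ofPred_eq, mem_sphere_zero_iff_norm, and_iff_right hu,
    InnerProductGeometry.angle, hc, hu, mul_one, div_one]
  have h := abs_le.1 (by simpa [hc, hu] using abs_real_inner_le_norm c u : |⟪c, u⟫| ≤ 1)
  conv_rhs => rw [← Real.cos_arccos h.1 h.2]
  exact (Real.strictAntiOn_cos.lt_iff_gt ⟨hδ0, hδ⟩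
    ⟨Real.arccos_nonneg _, Real.arccos_le_pi _⟩).symm

end FractalImmersion

theorem lemma3p1 (n : ℕ) (hn : 1 ≤ n) :
    ∃ δ₀ : ℝ, 0 < δ₀ ∧
      ∀ (α β γ : ℝ) (ν μ : ℝ → ℝ), FractalImmersion.IsAdmissible α β γ ν μ →
      ∀ c ∈ Metric.sphere (0 : EuclideanSpace ℝ (Fin n)) 1, ∀ δ : ℝ, 0 < δ → δ ≤ δ₀ →
      ∃ f : FractalImmersion.UnitSphere n → ℝ, ContMDiff (𝓡 n) 𝓘(ℝ, ℝ) ∞ f ∧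
      ∃ t₀ : ℝ, 0 < t₀ ∧ ∀ t ∈ Set.Ioo 0 t₀,
        FractalImmersion.IsSmoothImmersion (FractalImmersion.normalVariation ν μ f t) ∧
        (∀ p ∈ FractalImmersion.piece α
            (Metric.sphere 0 1 \ FractalImmersion.geodesicBall c δ) ∪
            {p : FractalImmersion.UnitSphere n | β ≤ (FractalImmersion.phi ν μ p).snd ^ 2},
          FractalImmersion.normalVariation ν μ f t p = FractalImmersion.phi ν μ p) ∧
        ∃ N : FractalImmersion.UnitSphere n → FractalImmersion.Ambient n,
          FractalImmersion.IsGaussMap (FractalImmersion.normalVariation ν μ f t) N ∧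
          (∀ p, 0 < ⟪N p, FractalImmersion.phiNormal ν μ p⟫) ∧
          ∀ p ∈ FractalImmersion.piece α (FractalImmersion.geodesicBall c δ),
            0 < FractalImmersion.gaussKronecker
              (FractalImmersion.normalVariation ν μ f t) N p := by
  open FractalImmersion in
  refine ⟨Real.pi, Real.pi_pos, fun α β γ ν μ h c hc δ hδ0 hδ => ?_⟩
  replace hc : ‖c‖ = 1 := mem_sphere_zero_iff_norm.1 hc
  have hfs := fun p : UnitSphere n =>
    contDiffAt_variationFactor h.alpha_lt_beta h.beta_lt_one (Real.cos δ) c p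
  refine ⟨fun p => variationFactor α β (Real.cos δ) c p, contMDiff_comp_coe hfs, ?_⟩
  obtain ⟨t₁, ht₁, hunit⟩ := h.exists_isUnit_frame hfs
  obtain ⟨C, hC, hbound⟩ := exists_bound_expNegInvGlue
  have hγ : 0 < √γ := Real.sqrt_pos.2 h.gamma_pos
  refine ⟨min t₁ (√γ / (6 * C)), by positivity, fun t ht => ?_⟩
  replace hunit : ∀ p : UnitSphere n, IsUnit (frame (variationExt α β (Real.cos δ) t ν μ c)
      (phiNormalExt β ν μ) (p : Ambient n)) :=
    hunit t ⟨ht.1, ht.2.trans_le (min_le_left _ _)⟩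
  have htC : 6 * t * C < √γ := by
    have h1 := ht.2.trans_le (min_le_right _ _)
    rw [lt_div_iff₀ (by positivity)] at h1
    linarith
  rw [h.normalVariation_eq]
  have hG := fun p : UnitSphere n => h.contDiffAt_variationExt (Real.cos δ) t c p
  have hGd := fun p : UnitSphere n => (hG p).differentiableAt (by simp)
  have hinj : ∀ p : UnitSphere n, Function.Injective
      (differential (fun q : UnitSphere n => variationExt α β (Real.cos δ) t ν μ c q) p) := by
    intro p
    refine (injective_iff_map_eq_zero _).2 fun v hv => ?_
    rw [differential_comp_coe (hGd p),
      ← frame_apply_tangent _ (phiNormalExt β ν μ) (inner_inclusionDifferential p v)] at hv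
    have h2 : inclusionDifferential p v = 0 := by
      have h3 := congrArg (fun A : Ambient n →L[ℝ] Ambient n => A (inclusionDifferential p v))
        (Ring.inverse_mul_cancel _ (hunit p))
      simpa [hv] using h3.symm
    exact inclusionDifferential_injective p (h2.trans (map_zero _).symm)
  have hW := fun p : UnitSphere n => conormal_ne_zero (hunit p) (norm_eq_of_mem_sphere p)
  have hN : ∀ p : UnitSphere n,
      ContDiffAt ℝ ∞ (variationNormal α β (Real.cos δ) t ν μ c) (p : Ambient n) := fun p =>
    contDiffAt_unitVector (contDiffAt_conormal (hG p) (h.contDiffAt_phiNormalExt p) (hunit p))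
      (hW p)
  have hN1 : ∀ p : UnitSphere n,
      ‖variationNormal α β (Real.cos δ) t ν μ c (p : Ambient n)‖ = 1 := fun p =>
    norm_unitVector (hW p)
  have hnormal : ∀ (p : UnitSphere n) v, ⟪variationNormal α β (Real.cos δ) t ν μ c (p : Ambient n),
      differential (fun q : UnitSphere n => variationExt α β (Real.cos δ) t ν μ c q) p v⟫ = 0 := by
    intro p v
    have h1 := inner_inclusionDifferential p v
    rw [differential_comp_coe (hGd p), variationNormal, unitVector, inner_smul_left,
      ← frame_apply_tangent _ (phiNormalExt β ν μ) h1, inner_conormal_frame (hunit p), h1, mul_zero]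
  refine ⟨⟨contMDiff_comp_coe hG, hinj⟩, ?_,
    fun p => variationNormal α β (Real.cos δ) t ν μ c p, ⟨contMDiff_comp_coe hN, hN1, hnormal⟩,
    ?_, ?_⟩
  · intro p hp
    have hf : variationFactor α β (Real.cos δ) c (p : Ambient n) = 0 := by
      rcases hp with ⟨hp1, hp2⟩ | hp
      · have h1 := norm_unitVector (h.fst_ne_zero hp1)
        have h2 : ¬ Real.cos δ < ⟪c, unitVector (p : Ambient n).fst⟫ := fun h3 =>
          hp2.2 ((mem_geodesicBall_iff hc hδ0.le hδ h1).2 h3)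
        rw [variationFactor_of_le h.alpha_lt_beta hp1, expNegInvGlue.zero_of_nonpos, mul_zero]
        linarith
      · exact variationFactor_of_ge h.alpha_lt_beta hp
    rw [h.phi_eq]
    simp [variationExt, hf]
  · intro p
    beta_reduce
    rw [h.phiNormal_eq, variationNormal, unitVector, inner_smul_left,
      inner_conormal_transversal (hunit p) (norm_eq_of_mem_sphere p), mul_one]
    exact inv_pos.2 (norm_pos_iff.2 (hW p))
  · rintro p ⟨hp1, hp2⟩
    have hpos := (mem_geodesicBall_iff hc hδ0.le hδ (norm_unitVector (h.fst_ne_zero hp1))).1 hp2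
    have hNd := (hN p).differentiableAt (by simp)
    refine gaussKronecker_pos (hinj p) (hN1 p) (hnormal p) (fun v => ?_) fun v hv => ?_
    · rw [differential_comp_coe hNd]
      have hv := inner_inclusionDifferential p v
      have h1 := fderiv_eq_zero_of_const_on_sphere (C := (1 : ℝ))
        (q := fun q : Ambient n => ‖variationNormal α β (Real.cos δ) t ν μ c q‖ ^ 2)
        (fun q => by rw [hN1, one_pow]) (hNd.norm_sq ℝ) hv
      have h2 := (hasDerivAt_comp_line hNd (inclusionDifferential p v)).norm_sq
      have h3 := (hasDerivAt_comp_line (hNd.norm_sq ℝ) (inclusionDifferential p v)).unique h2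
      rw [h1] at h3
      simpa using h3.symm
    · rw [differential_comp_coe (hGd p), differential_comp_coe hNd]
      refine h.inner_fderiv_variation_pos ht.1 hc (Real.abs_cos_le_one δ) hC htC hbound hunit hp1
        hpos (inner_inclusionDifferential p v) fun h0 => hv ?_
      exact inclusionDifferential_injective p (h0.trans (map_zero _).symm)
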